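/- Let $\mathbb A$ be a countably infinite set of names. A nominal set is a set with an action of the finite permutations of $\mathbb A$ in which every element $x$ has a finite supporting set; $\mathrm{supp}(x)$ is the least finite one. Let $\mathcal L=\langle\mathcal S,L,\to\rangle$ be a fresh nominal labelled transition system: $\mathcal S$ (states) and $L$ (actions) are nominal sets; the configurations are the pairs $(s,H)$ with $s\in\mathcal S$ and $H\subseteq\mathbb A$ finite, $\mathrm{supp}(s)\subseteq H$; $\to$ is an equivariant relation between configurations, labelled by $L$; each set $\{(\ell,(s',H'))\mid (s,H)\xrightarrow{\ell}(s',H')\}$ is fixed by every finite permutation that fixes $\mathrm{supp}(s)$ pointwise and maps $H\setminus\mathrm{supp}(s)$ onto itself; and $(s,H)\xrightarrow{\ell}(s',H')$ implies $\mathrm{supp}(s')\subseteq\mathrm{supp}(s)\cup\mathrm{supp}(\ell)$ and $H'=H\cup\mathrm{supp}(\ell)$. Assume that $\mathcal L$ is fresh-orbit-finite, i.e. that $\mathcal S$ and $L$ have finitely many orbits. Actions are written as tagged tuples $(t,\vec a)$ of names, by a partial equivariant map from such tuples to $L$. Fresh HML formulas with recursion (fHML) are given by $$\varphi ::= u=v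 \mid u\ne v\mid X(\vec u)\mid \neg\varphi\mid \varphi\vee\varphi\mid\varphi\wedge\varphi\mid\textstyle\bigvee_x\varphi\mid\bigwedge_x\varphi\mid \mathsf{F}_x\varphi\mid\overline{\mathsf F}_x\varphi\mid\langle t,\vec u\rangle\varphi\mid[t,\vec u]\varphi\mid(\mu X(\vec x).\varphi)(\vec u)\mid(\nu X(\vec x).\varphi)(\vec u),$$ where $u,v,\vec u$ are names or name variables and each recursion variable $X$ has a fixed arity. A valuation $\xi$ assigns to each recursion variable of arity $n$ a function from $\mathbb A^n$ to sets of configurations. The denotation $[\![\varphi]\!]_\xi$ of a formula without free name variables is a set of configurations: $\bigvee_x,\bigwedge_x$ are the union and intersection of $[\![\varphi\{a/x\}]\!]_\xi$ over all names $a$; $(s,H)\in[\![\mathsf F_x\varphi]\!]_\xi$ (resp. $[\![\overline{\mathsf F}_x\varphi]\!]_\xi$) iff $(s,H)\in[\![\varphi\{a/x\}]\!]_\xi$ for some (resp. all) $a\in\mathbb A\setminus H$; $[\![X(\vec a)]\!]_\xi=\xi(X)(\vec a)$; $[\![(\mu X(\vec x).\varphi)(\vec a)]\!]_\xi$ and $[\![(\nu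 X(\vec x).\varphi)(\vec a)]\!]_\xi$ are the values at $\vec a$ of the least and the greatest fixpoint of $f\mapsto(\vec b\mapsto[\![\varphi\{\vec b/\vec x\}]\!]_{\xi[X\mapsto f]})$; the other clauses are the usual ones. Let $\varphi$ be a negation-free fHML formula without free name variables, in which the parameters of each fixpoint operator are pairwise distinct, no recursion variable is bound twice, and none is both free and bound. The parity game of $\mathcal L$ and $\varphi$ has positions $(s,H,\xi,\psi)$. Defender moves at $\vee,\bigvee_x,\mathsf F_x,\langle t,\vec a\rangle$, Attacker at $\wedge,\bigwedge_x,\overline{\mathsf F}_x,[t,\vec a]$; a move chooses a disjunct or conjunct, an instance $\psi\{a/x\}$ (with $a\notin H$ for $\mathsf F_x,\overline{\mathsf F}_x$), or a transition $(s,H)\xrightarrow{t,\vec a}(s',H')$, respectively. From $(\sigma X(\vec x).\psi)(\vec a)$, $\sigma\in\{\mu,\nu\}$, the only move is to $(\psi\{\sigma X(\vec x).\psi/X\})\{\vec a/\vec x\}$. Positions with a formula $a=b$, $a\neq b$ or $X(\vec a)$ have no moves and are won by Defender iff the formula holds (for $X(\vec a)$: iff $(s,H)\in\xi(X)(\vec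 a)$). A player who cannot move at a position of theirs loses. The ranks $\Omega$ are any natural numbers with $\Omega(X)$ odd for $\mu$-variables and even for $\nu$-variables of $\varphi$, and $\Omega(X)\ge\Omega(Y)$ whenever the bound variable $X$ occurs free in the fixpoint subformula of $\varphi$ that binds $Y$; a position with formula $(\sigma X(\vec x).\psi)(\vec a)$ has rank $\Omega(X)$, and all others have rank $0$. Defender wins an infinite play iff the greatest rank occurring infinitely often is even. Strategies are positional. Then for every valuation $\xi$ and every configuration $(s,H)$, $$(s,H)\in[\![\varphi]\!]_\xi\iff\text{Defender has a winning strategy from the position }(s,H,\xi,\varphi).$$ -/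

import Mathlib

open scoped Pointwise

namespace FHML

universe u v w t

/-! ## Nominal sets over a set `A` of names -/

/-- The group of finite permutations of the set `A` of names. -/
def FinPerm (A : Type u) : Subgroup (Equiv.Perm A) where
  carrier := {π | {a | π a ≠ a}.Finite}
  one_mem' := by simp
  mul_mem' := by
    intro π ρ hπ hρ
    refine (hπ.union hρ).subset ?_
    intro a ha
    by_contra h
    simp only [Set.mem_union, Set.mem_ofPred_eq, not_or, not_not] at h
    exact ha (by rw [Equiv.Perm.mul_apply, h.2, h.1])
  inv_mem' := by
    intro π hπ
    refine Set.Finite.subset hπ ?_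
    intro a ha h
    exact ha (by rw [Equiv.Perm.inv_eq_iff_eq, h])

/-- A nominal set: a set with an action of the finite permutations all of whose elements have a
finite supporting set of names. -/
class NominalSet (A : Type u) (X : Type v) extends MulAction (FinPerm A) X where
  exists_finite_supports : ∀ x : X, ∃ N : Set A, N.Finite ∧ MulAction.Supports (FinPerm A) N x

/-- The support of `x`, the least finite set of names that supports `x`. -/
def supp (A : Type u) {X : Type v} [NominalSet A X] (x : X) : Set A :=
  ⋂₀ {N | N.Finite ∧ MulAction.Supports (FinPerm A) N x}

/-- A nominal set is orbit-finite if it has finitely many orbits. -/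
def OrbitFinite (A : Type u) (X : Type v) [NominalSet A X] : Prop :=
  Finite (MulAction.orbitRel.Quotient (FinPerm A) X)

/-- The pair `(N', N)` of sets of names, `N' ⊆ N`, freshly supports `x`: every finite permutation
that fixes each name in `N'` and preserves the set `N \ N'` fixes `x`. -/
def FreshlySupports {A : Type u} {X : Type v} [MulAction (FinPerm A) X] (N' N : Set A) (x : X) : Prop :=
  ∀ π : FinPerm A, (∀ a ∈ N', π • a = a) → π • (N \ N') = N \ N' → π • x = x

theorem supp_smul_subset {A : Type u} {X : Type v} [NominalSet A X] (π : FinPerm A) (x : X) :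
    supp A (π • x) ⊆ π • supp A x := by
  intro a ha
  rw [Set.mem_smul_set_iff_inv_smul_mem]
  rintro N ⟨hN, hs⟩
  rw [← Set.mem_smul_set_iff_inv_smul_mem]
  refine ha _ ⟨hN.smul_set, ?_⟩
  intro ρ hρ
  have h : (π⁻¹ * ρ * π) • x = x := by
    apply hs
    intro b hb
    have h1 := hρ (Set.smul_mem_smul_set (a := π) hb)
    rw [mul_smul, mul_smul, h1, inv_smul_smul]
  rw [mul_smul, mul_smul, inv_smul_eq_iff] at h
  exact h

/-! ## Fresh labelled transition systems -/

/-- Configurations: a state together with a finite history containing the names of the state. -/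
@[ext]
structure Conf (A : Type u) (S : Type v) [NominalSet A S] where
  state : S
  hist : Finset A
  supp_subset : supp A state ⊆ (hist : Set A)

/-- Permutations act on configurations componentwise. -/
instance {A : Type u} {S : Type v} [DecidableEq A] [NominalSet A S] : MulAction (FinPerm A) (Conf A S) where
  smul π c := ⟨π • c.state, π • c.hist, by
    rw [Finset.coe_smul_finset]
    exact (supp_smul_subset π c.state).trans (Set.smul_set_mono c.supp_subset)⟩
  one_smul c := Conf.ext (one_smul _ c.state) (one_smul _ c.hist)
  mul_smul π ρ c := Conf.ext (mul_smul π ρ c.state) (mul_smul π ρ c.hist)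

/-- A fresh nominal labelled transition system (FLTS) with states `S` and actions `L`. -/
structure FLTS (A : Type u) (S : Type v) (L : Type w) [DecidableEq A] [NominalSet A S]
    [NominalSet A L] where
  /-- `Tr c ℓ c'`: there is an `ℓ`-transition from `c` to `c'`. -/
  Tr : Conf A S → L → Conf A S → Prop
  equivariant : ∀ (π : FinPerm A) (c : Conf A S) (ℓ : L) (c' : Conf A S),
    Tr c ℓ c' ↔ Tr (π • c) (π • ℓ) (π • c')
  freshly_supported : ∀ c : Conf A S,
    FreshlySupports (supp A c.state) (c.hist : Set A) {p : L × Conf A S | Tr c p.1 p.2}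
  supp_target : ∀ (c : Conf A S) (ℓ : L) (c' : Conf A S), Tr c ℓ c' →
    supp A c'.state ⊆ supp A c.state ∪ supp A ℓ
  hist_target : ∀ (c : Conf A S) (ℓ : L) (c' : Conf A S), Tr c ℓ c' →
    (c'.hist : Set A) = (c.hist : Set A) ∪ supp A ℓ

/-- An FLTS is fresh-orbit-finite if its sets of states and of actions are orbit-finite. -/
def FLTS.FreshOrbitFinite {A : Type u} {S : Type v} {L : Type w} [DecidableEq A]
    [NominalSet A S] [NominalSet A L] (_ : FLTS A S L) : Prop :=
  OrbitFinite A S ∧ OrbitFinite A L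

/-- The actions named by tagged tuples of names: `toFun t as` is the action written `(t, as)`, if
there is one.  For `L` a set of tagged tuples of names, `toFun t as` is `(t, as)` when this pair
belongs to `L`, and `none` otherwise. -/
structure ActionTerms (A : Type u) (T : Type t) (L : Type w) [NominalSet A L] where
  toFun : T → List A → Option L
  equivariant : ∀ (π : FinPerm A) (t : T) (as : List A),
    toFun t (as.map (π • ·)) = (toFun t as).map (π • ·)

/-! ## Syntax of fHML -/

/-- Recursion variables; there are infinitely many of each arity. -/
structure RVar where
  name : ℕ
  arity : ℕ
  deriving DecidableEq

/-- Names and name variables. -/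
inductive Term (A : Type u) : Type u
  | name (a : A)
  | var (x : ℕ)

/-- The two kinds of fixpoints. -/
inductive FixKind
  | mu
  | nu

/-- fHML formulas over names `A` and tags `T`. -/
inductive Formula (A : Type u) (T : Type t) : Type (max u t)
  /-- `u = v` -/
  | eq (u v : Term A)
  /-- `u ≠ v` -/
  | ne (u v : Term A)
  /-- `X(us)` -/
  | rvar (X : RVar) (us : Fin X.arity → Term A)
  /-- negation -/
  | neg (φ : Formula A T)
  | or (φ₁ φ₂ : Formula A T)
  | and (φ₁ φ₂ : Formula A T)
  /-- disjunction over all names for `x` -/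
  | bigOr (x : ℕ) (φ : Formula A T)
  /-- conjunction over all names for `x` -/
  | bigAnd (x : ℕ) (φ : Formula A T)
  /-- for some fresh name for `x` -/
  | fresh (x : ℕ) (φ : Formula A T)
  /-- for all fresh names for `x` -/
  | freshAll (x : ℕ) (φ : Formula A T)
  /-- `⟨t, us⟩φ` -/
  | dia (t : T) (us : List (Term A)) (φ : Formula A T)
  /-- `[t, us]φ` -/
  | box (t : T) (us : List (Term A)) (φ : Formula A T)
  /-- `(σX(xs).φ)(us)` -/
  | fix (σ : FixKind) (X : RVar) (xs : Fin X.arity → ℕ) (φ : Formula A T)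
      (us : Fin X.arity → Term A)

/-- Instantiation of the name variables in a term. -/
def Term.inst {A : Type u} (γ : ℕ → Option A) : Term A → Term A
  | .name a => .name a
  | .var x => match γ x with
    | some a => .name a
    | none => .var x

namespace Formula

variable {A : Type u} {T : Type t}

/-- `φ.inst γ` replaces each free name variable `x` with `γ x = some a` by the name `a`. -/
noncomputable def inst : (ℕ → Option A) → Formula A T → Formula A T
  | γ, eq u v => eq (u.inst γ) (v.inst γ)
  | γ, ne u v => ne (u.inst γ) (v.inst γ)
  | γ, rvar X us => rvar X (fun i => (us i).inst γ)
  | γ, neg φ => neg (φ.inst γ)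
  | γ, or φ₁ φ₂ => or (φ₁.inst γ) (φ₂.inst γ)
  | γ, and φ₁ φ₂ => and (φ₁.inst γ) (φ₂.inst γ)
  | γ, bigOr x φ => bigOr x (φ.inst (Function.update γ x none))
  | γ, bigAnd x φ => bigAnd x (φ.inst (Function.update γ x none))
  | γ, fresh x φ => fresh x (φ.inst (Function.update γ x none))
  | γ, freshAll x φ => freshAll x (φ.inst (Function.update γ x none))
  | γ, dia t us φ => dia t (us.map (Term.inst γ)) (φ.inst γ)
  | γ, box t us φ => box t (us.map (Term.inst γ)) (φ.inst γ)
  | γ, fix σ X xs φ us =>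
      fix σ X xs (φ.inst (Function.extend xs (fun _ => none) γ)) (fun i => (us i).inst γ)

/-- `φ{a/x}` -/
noncomputable def inst1 (φ : Formula A T) (x : ℕ) (a : A) : Formula A T :=
  φ.inst (Function.update (fun _ => none) x (some a))

/-- `φ{as/xs}` (simultaneously), for pairwise distinct `xs` -/
noncomputable def instN (φ : Formula A T) {n : ℕ} (xs : Fin n → ℕ) (as : Fin n → A) :
    Formula A T :=
  φ.inst (Function.extend xs (fun i => some (as i)) (fun _ => none))

/-- Replacement of each free occurrence `X(us)` of each recursion variable `X` by `θ X us`. It is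
only used where no variable can be captured. -/
def rsubst : (∀ X : RVar, (Fin X.arity → Term A) → Formula A T) → Formula A T → Formula A T
  | _, eq u v => eq u v
  | _, ne u v => ne u v
  | θ, rvar X us => θ X us
  | θ, neg φ => neg (φ.rsubst θ)
  | θ, or φ₁ φ₂ => or (φ₁.rsubst θ) (φ₂.rsubst θ)
  | θ, and φ₁ φ₂ => and (φ₁.rsubst θ) (φ₂.rsubst θ)
  | θ, bigOr x φ => bigOr x (φ.rsubst θ)
  | θ, bigAnd x φ => bigAnd x (φ.rsubst θ)
  | θ, fresh x φ => fresh x (φ.rsubst θ)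
  | θ, freshAll x φ => freshAll x (φ.rsubst θ)
  | θ, dia t us φ => dia t us (φ.rsubst θ)
  | θ, box t us φ => box t us (φ.rsubst θ)
  | θ, fix σ X xs φ us => fix σ X xs (φ.rsubst (Function.update θ X (rvar X))) us

/-- The unfolding `(φ{σX(xs).φ / X}){as/xs}` of `(σX(xs).φ)(as)`. -/
noncomputable def unfold (σ : FixKind) (X : RVar) (xs : Fin X.arity → ℕ) (φ : Formula A T)
    (as : Fin X.arity → A) : Formula A T :=
  (φ.rsubst (Function.update rvar X (fix σ X xs φ))).instN xs as

/-- The number of symbols other than terms. -/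
def size : Formula A T → ℕ
  | eq _ _ | ne _ _ | rvar _ _ => 1
  | neg φ | bigOr _ φ | bigAnd _ φ | fresh _ φ | freshAll _ φ | dia _ _ φ | box _ _ φ
  | fix _ _ _ φ _ => φ.size + 1
  | or φ₁ φ₂ | and φ₁ φ₂ => φ₁.size + φ₂.size + 1

@[simp]
theorem size_inst (γ : ℕ → Option A) (φ : Formula A T) : (φ.inst γ).size = φ.size := by
  induction φ generalizing γ <;> simp_all [inst, size]

@[simp]
theorem size_inst1 (φ : Formula A T) (x : ℕ) (a : A) : (φ.inst1 x a).size = φ.size :=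
  size_inst _ _

@[simp]
theorem size_instN (φ : Formula A T) {n : ℕ} (xs : Fin n → ℕ) (as : Fin n → A) :
    (φ.instN xs as).size = φ.size :=
  size_inst _ _

/-- The set of subformulas. -/
def subformulas : Formula A T → Set (Formula A T)
  | eq u v => {eq u v}
  | ne u v => {ne u v}
  | rvar X us => {rvar X us}
  | neg φ => insert (neg φ) φ.subformulas
  | or φ₁ φ₂ => insert (or φ₁ φ₂) (φ₁.subformulas ∪ φ₂.subformulas)
  | and φ₁ φ₂ => insert (and φ₁ φ₂) (φ₁.subformulas ∪ φ₂.subformulas)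
  | bigOr x φ => insert (bigOr x φ) φ.subformulas
  | bigAnd x φ => insert (bigAnd x φ) φ.subformulas
  | fresh x φ => insert (fresh x φ) φ.subformulas
  | freshAll x φ => insert (freshAll x φ) φ.subformulas
  | dia t us φ => insert (dia t us φ) φ.subformulas
  | box t us φ => insert (box t us φ) φ.subformulas
  | fix σ X xs φ us => insert (fix σ X xs φ us) φ.subformulas

/-- The set of free name variables. -/
def freeNames : Formula A T → Set ℕ
  | eq u v | ne u v => {x | u = .var x ∨ v = .var x}
  | rvar _ us => {x | ∃ i, us i = .var x}
  | neg φ => φ.freeNames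
  | or φ₁ φ₂ | and φ₁ φ₂ => φ₁.freeNames ∪ φ₂.freeNames
  | bigOr x φ | bigAnd x φ | fresh x φ | freshAll x φ => φ.freeNames \ {x}
  | dia _ us φ | box _ us φ => {x | .var x ∈ us} ∪ φ.freeNames
  | fix _ _ xs φ us => (φ.freeNames \ Set.range xs) ∪ {x | ∃ i, us i = .var x}

/-- The set of free recursion variables. -/
def freeRVars : Formula A T → Set RVar
  | eq _ _ | ne _ _ => ∅
  | rvar X _ => {X}
  | neg φ | bigOr _ φ | bigAnd _ φ | fresh _ φ | freshAll _ φ | dia _ _ φ | box _ _ φ =>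
      φ.freeRVars
  | or φ₁ φ₂ | and φ₁ φ₂ => φ₁.freeRVars ∪ φ₂.freeRVars
  | fix _ X _ φ _ => φ.freeRVars \ {X}

/-- The list of recursion variables bound in a formula, one entry for each fixpoint operator. -/
def boundRVars : Formula A T → List RVar
  | eq _ _ | ne _ _ | rvar _ _ => []
  | neg φ | bigOr _ φ | bigAnd _ φ | fresh _ φ | freshAll _ φ | dia _ _ φ | box _ _ φ =>
      φ.boundRVars
  | or φ₁ φ₂ | and φ₁ φ₂ => φ₁.boundRVars ++ φ₂.boundRVars
  | fix _ X _ φ _ => X :: φ.boundRVars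

/-- No negation occurs in the formula (`u ≠ v` is not counted as a negation). -/
def NegationFree (ψ : Formula A T) : Prop :=
  ∀ φ, neg φ ∉ ψ.subformulas

/-- The usual conventions on variables: there are no free name variables; the parameters of each
fixpoint operator are pairwise distinct; each recursion variable is bound at most once, and
none is both free and bound. -/
structure WellNamed (ψ : Formula A T) : Prop where
  closed : ψ.freeNames = ∅
  params_injective : ∀ σ X xs φ us, fix σ X xs φ us ∈ ψ.subformulas → Function.Injective xs
  bound_nodup : ψ.boundRVars.Nodup
  free_not_bound : ∀ X ∈ ψ.freeRVars, X ∉ ψ.boundRVars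

/-- A ranking of the recursion variables bound in `ψ`: least-fixpoint variables have odd and
greatest-fixpoint variables have even rank, and if `X` occurs free in the fixpoint subformula that
binds `Y`, then the rank of `X` is at least that of `Y`. -/
structure IsRanking (ψ : Formula A T) (Ω : RVar → ℕ) : Prop where
  odd_mu : ∀ X xs φ us, fix .mu X xs φ us ∈ ψ.subformulas → Odd (Ω X)
  even_nu : ∀ X xs φ us, fix .nu X xs φ us ∈ ψ.subformulas → Even (Ω X)
  le_of_dep : ∀ X ∈ ψ.boundRVars, ∀ σ Y ys φ us, fix σ Y ys φ us ∈ ψ.subformulas →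
    X ∈ (fix σ Y ys φ us).freeRVars → Ω Y ≤ Ω X

/-- The successor-like operation that gives a fixpoint variable a rank of the right parity. -/
def _root_.FHML.FixKind.rankAbove : FixKind → ℕ → ℕ
  | .mu, n => if Even n then n + 1 else n
  | .nu, n => if Even n then n else n + 1

/-- The greatest rank of a fixpoint operator in a formula, for the least ranking in which the ranks
do not decrease from inner to outer fixpoint operators. -/
def maxRank : Formula A T → ℕ
  | eq _ _ | ne _ _ | rvar _ _ => 0
  | neg φ | bigOr _ φ | bigAnd _ φ | fresh _ φ | freshAll _ φ | dia _ _ φ | box _ _ φ => φ.maxRank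
  | or φ₁ φ₂ | and φ₁ φ₂ => max φ₁.maxRank φ₂.maxRank
  | fix σ _ _ φ _ => σ.rankAbove φ.maxRank

/-- The ranks of the recursion variables bound in a formula, for the same ranking. -/
def leastRanking : Formula A T → RVar → ℕ
  | eq _ _, _ | ne _ _, _ | rvar _ _, _ => 0
  | neg φ, X | bigOr _ φ, X | bigAnd _ φ, X | fresh _ φ, X | freshAll _ φ, X | dia _ _ φ, X
  | box _ _ φ, X => φ.leastRanking X
  | or φ₁ φ₂, X | and φ₁ φ₂, X => max (φ₁.leastRanking X) (φ₂.leastRanking X)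
  | fix σ Y _ φ _, X => if X = Y then σ.rankAbove φ.maxRank else φ.leastRanking X

theorem _root_.FHML.FixKind.le_rankAbove (σ : FixKind) (n : ℕ) : n ≤ σ.rankAbove n := by
  cases σ <;> simp only [FixKind.rankAbove] <;> split_ifs <;> omega

theorem leastRanking_le (φ : Formula A T) (X : RVar) : φ.leastRanking X ≤ φ.maxRank := by
  induction φ with
  | fix σ Y ys φ us ih =>
    simp only [leastRanking, maxRank]
    split_ifs
    · exact le_rfl
    · exact ih.trans (FixKind.le_rankAbove _ _)
  | _ => simp_all [leastRanking, maxRank] <;> omega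

theorem leastRanking_eq_zero (φ : Formula A T) (X : RVar) (h : X ∉ φ.boundRVars) :
    φ.leastRanking X = 0 := by
  induction φ with
  | _ => simp_all [leastRanking, boundRVars]

theorem mem_boundRVars_of_fix_mem {φ χ : Formula A T} {σ X xs us}
    (h : fix σ X xs χ us ∈ φ.subformulas) : X ∈ φ.boundRVars := by
  induction φ with
  | fix τ Y ys φ vs ih =>
    simp only [subformulas, Set.mem_insert_iff] at h
    rcases h with h | h
    · cases h; simp [boundRVars]
    · simp [boundRVars, ih h]
  | or φ₁ φ₂ ih₁ ih₂ | and φ₁ φ₂ ih₁ ih₂ =>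
    simp only [subformulas, Set.mem_insert_iff, Set.mem_union, reduceCtorEq, false_or] at h
    simp only [boundRVars, List.mem_append]
    exact h.imp ih₁ ih₂
  | _ => simp_all [subformulas, boundRVars]

theorem mem_free_or_bound {φ χ : Formula A T} (h : χ ∈ φ.subformulas) {X : RVar}
    (hX : X ∈ χ.freeRVars) : X ∈ φ.freeRVars ∨ X ∈ φ.boundRVars := by
  induction φ with
  | fix τ Y ys φ vs ih =>
    simp only [subformulas, Set.mem_insert_iff] at h
    rcases h with rfl | h
    · exact .inl hX
    · simp only [freeRVars, boundRVars, Set.mem_sdiff, Set.mem_singleton_iff, List.mem_cons]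
      have := ih h
      tauto
  | or φ₁ φ₂ ih₁ ih₂ | and φ₁ φ₂ ih₁ ih₂ =>
    simp only [subformulas, Set.mem_insert_iff, Set.mem_union] at h
    rcases h with rfl | h | h
    · exact .inl hX
    · have := ih₁ h
      simp only [freeRVars, boundRVars, Set.mem_union, List.mem_append]
      tauto
    · have := ih₂ h
      simp only [freeRVars, boundRVars, Set.mem_union, List.mem_append]
      tauto
  | eq u v | ne u v | rvar Y us =>
    simp only [subformulas, Set.mem_singleton_iff] at h
    subst h
    exact .inl hX
  | _ =>
    simp only [subformulas, Set.mem_insert_iff] at h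
    rcases h with rfl | h
    · exact .inl hX
    · simp_all [freeRVars, boundRVars]

theorem leastRanking_parity {φ χ : Formula A T} {σ X xs us} (hn : φ.boundRVars.Nodup)
    (h : fix σ X xs χ us ∈ φ.subformulas) :
    ∃ n, φ.leastRanking X = σ.rankAbove n := by
  induction φ with
  | fix τ Y ys φ vs ih =>
    simp only [subformulas, Set.mem_insert_iff] at h
    simp only [boundRVars, List.nodup_cons] at hn
    rcases h with h | h
    · cases h; simp [leastRanking]
    · have hXY : X ≠ Y := by
        rintro rfl
        exact hn.1 (mem_boundRVars_of_fix_mem h)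
      simpa [leastRanking, hXY] using ih hn.2 h
  | or φ₁ φ₂ ih₁ ih₂ | and φ₁ φ₂ ih₁ ih₂ =>
    simp only [subformulas, Set.mem_insert_iff, Set.mem_union, reduceCtorEq, false_or] at h
    simp only [boundRVars, List.nodup_append'] at hn
    simp only [leastRanking]
    rcases h with h | h
    · rw [leastRanking_eq_zero φ₂ X (hn.2.2 (mem_boundRVars_of_fix_mem h))]
      simpa using ih₁ hn.1 h
    · rw [leastRanking_eq_zero φ₁ X (fun h' => hn.2.2 h' (mem_boundRVars_of_fix_mem h))]
      simpa using ih₂ hn.2.1 h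
  | _ => simp_all [subformulas, boundRVars, leastRanking]

theorem leastRanking_dep {φ χ : Formula A T} {σ X Y ys us} (hn : φ.boundRVars.Nodup)
    (hd : ∀ Z ∈ φ.freeRVars, Z ∉ φ.boundRVars) (hX : X ∈ φ.boundRVars)
    (h : fix σ Y ys χ us ∈ φ.subformulas) (hf : X ∈ (fix σ Y ys χ us).freeRVars) :
    φ.leastRanking Y ≤ φ.leastRanking X := by
  induction φ with
  | fix τ Z zs φ vs ih =>
    simp only [subformulas, Set.mem_insert_iff] at h
    rcases h with h | h
    · rw [h] at hf
      exact absurd hX (hd X hf)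
    · simp only [boundRVars, List.nodup_cons, List.mem_cons] at hn hX
      have hYZ : Y ≠ Z := by
        rintro rfl
        exact hn.1 (mem_boundRVars_of_fix_mem h)
      by_cases hXZ : X = Z
      · simp only [leastRanking, hXZ, hYZ, if_true, if_false]
        exact (leastRanking_le _ _).trans (FixKind.le_rankAbove _ _)
      · simp only [leastRanking, hXZ, hYZ, if_false]
        refine ih hn.2 ?_ (hX.resolve_left hXZ) h
        intro W hW hW'
        by_cases hWZ : W = Z
        · exact hn.1 (hWZ ▸ hW')
        · exact hd W ⟨hW, hWZ⟩ (by simp [boundRVars, hW'])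
  | or φ₁ φ₂ ih₁ ih₂ | and φ₁ φ₂ ih₁ ih₂ =>
    simp only [subformulas, Set.mem_insert_iff, Set.mem_union, reduceCtorEq, false_or] at h
    simp only [boundRVars, List.nodup_append', List.mem_append, freeRVars, Set.mem_union]
      at hn hX hd
    simp only [leastRanking]
    rcases h with h | h
    · have hX₁ : X ∈ φ₁.boundRVars := (mem_free_or_bound h hf).resolve_left
        (fun h' => hd X (.inl h') hX)
      rw [leastRanking_eq_zero φ₂ Y (hn.2.2 (mem_boundRVars_of_fix_mem h)),
        leastRanking_eq_zero φ₂ X (hn.2.2 hX₁)]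
      simpa using ih₁ hn.1 (fun Z h₁ h₂ => hd Z (.inl h₁) (.inl h₂)) hX₁ h
    · have hX₂ : X ∈ φ₂.boundRVars := (mem_free_or_bound h hf).resolve_left
        (fun h' => hd X (.inr h') hX)
      rw [leastRanking_eq_zero φ₁ Y (fun h' => hn.2.2 h' (mem_boundRVars_of_fix_mem h)),
        leastRanking_eq_zero φ₁ X (fun h' => hn.2.2 h' hX₂)]
      simpa using ih₂ hn.2.1 (fun Z h₁ h₂ => hd Z (.inr h₁) (.inr h₂)) hX₂ h
  | _ => simp_all [subformulas, boundRVars, leastRanking, freeRVars]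

/-- Every formula has a ranking. -/
theorem WellNamed.isRanking_leastRanking {ψ : Formula A T} (h : ψ.WellNamed) :
    ψ.IsRanking ψ.leastRanking where
  odd_mu X xs φ us hs := by
    obtain ⟨n, hn⟩ := leastRanking_parity h.bound_nodup hs
    rw [hn]
    simp only [FixKind.rankAbove]
    split_ifs with hp
    · exact hp.add_one
    · exact Nat.not_even_iff_odd.mp hp
  even_nu X xs φ us hs := by
    obtain ⟨n, hn⟩ := leastRanking_parity h.bound_nodup hs
    rw [hn]
    simp only [FixKind.rankAbove]
    split_ifs with hp
    · exact hp
    · exact (Nat.not_even_iff_odd.mp hp).add_one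
  le_of_dep X hX σ Y ys φ us hs hf :=
    leastRanking_dep h.bound_nodup h.free_not_bound hX hs hf

end Formula

/-! ## Semantics of fHML -/

/-- Valuations: each recursion variable of arity `n` is assigned a function that sends `n`-tuples
of names to sets of configurations. -/
abbrev Valuation (A : Type u) (S : Type v) [NominalSet A S] : Type (max u v) :=
  ∀ X : RVar, (Fin X.arity → A) → Set (Conf A S)

section Semantics

variable {A : Type u} {S : Type v} {L : Type w} {T : Type t} [DecidableEq A]
    [NominalSet A S] [NominalSet A L]

/-- `c'` is reached from `c` by a transition whose action is the one written `(t, us)`. -/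
def FLTS.Step (𝓛 : FLTS A S L) (act : ActionTerms A T L) (t : T) (us : List (Term A))
    (c c' : Conf A S) : Prop :=
  ∃ as ℓ, us = as.map Term.name ∧ act.toFun t as = some ℓ ∧ 𝓛.Tr c ℓ c'

/-- The denotation `⟦φ⟧ξ` of a formula without free name variables. -/
def FLTS.sem (𝓛 : FLTS A S L) (act : ActionTerms A T L) :
    Formula A T → Valuation A S → Set (Conf A S)
  | .eq u v, _ => {_c | u = v}
  | .ne u v, _ => {_c | u ≠ v}
  | .rvar X us, ξ => {c | ∃ as, us = Term.name ∘ as ∧ c ∈ ξ X as}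
  | .neg φ, ξ => (𝓛.sem act φ ξ)ᶜ
  | .or φ₁ φ₂, ξ => 𝓛.sem act φ₁ ξ ∪ 𝓛.sem act φ₂ ξ
  | .and φ₁ φ₂, ξ => 𝓛.sem act φ₁ ξ ∩ 𝓛.sem act φ₂ ξ
  | .bigOr x φ, ξ => ⋃ a : A, 𝓛.sem act (φ.inst1 x a) ξ
  | .bigAnd x φ, ξ => ⋂ a : A, 𝓛.sem act (φ.inst1 x a) ξ
  | .fresh x φ, ξ => {c | ∃ a : A, a ∉ c.hist ∧ c ∈ 𝓛.sem act (φ.inst1 x a) ξ}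
  | .freshAll x φ, ξ => {c | ∀ a : A, a ∉ c.hist → c ∈ 𝓛.sem act (φ.inst1 x a) ξ}
  | .dia t us φ, ξ => {c | ∃ c', 𝓛.Step act t us c c' ∧ c' ∈ 𝓛.sem act φ ξ}
  | .box t us φ, ξ => {c | ∀ c', 𝓛.Step act t us c c' → c' ∈ 𝓛.sem act φ ξ}
  | .fix .mu X xs φ us, ξ => {c | ∃ as, us = Term.name ∘ as ∧
      c ∈ sInf {f : (Fin X.arity → A) → Set (Conf A S) |
        (fun bs => 𝓛.sem act (φ.instN xs bs) (Function.update ξ X f)) ≤ f} as}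
  | .fix .nu X xs φ us, ξ => {c | ∃ as, us = Term.name ∘ as ∧
      c ∈ sSup {f : (Fin X.arity → A) → Set (Conf A S) |
        f ≤ (fun bs => 𝓛.sem act (φ.instN xs bs) (Function.update ξ X f))} as}
termination_by φ => φ.size
decreasing_by all_goals simp only [Formula.size, Formula.size_inst1, Formula.size_instN]; omega

end Semantics

/-! ## Parity games -/

inductive Player
  | defender
  | attacker

/-- Parity games between Defender and Attacker, on a possibly infinite set of positions. -/
structure ParityGame where
  Pos : Type u
  owner : Pos → Player
  Move : Pos → Pos → Prop
  rank : Pos → ℕ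

namespace ParityGame

variable (G : ParityGame.{u})

/-- The moves that are allowed when Defender follows the positional strategy `τ`. -/
def Follows (τ : G.Pos → G.Pos) (p q : G.Pos) : Prop :=
  G.Move p q ∧ (G.owner p = .defender → q = τ p)

/-- Defender wins an infinite play if the greatest rank that occurs infinitely often is even. -/
def DefenderWinsPlay (w : ℕ → G.Pos) : Prop :=
  ∃ d, Even d ∧ (∃ᶠ n in Filter.atTop, G.rank (w n) = d) ∧
    ∀ᶠ n in Filter.atTop, G.rank (w n) ≤ d

/-- Defender wins all plays from `p` by following `τ`: `τ` gives a legal move at each Defender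
position that is reached (so that Defender never gets stuck; a stuck player loses), and all infinite
plays are won by Defender. -/
def IsWinningStrategy (τ : G.Pos → G.Pos) (p : G.Pos) : Prop :=
  (∀ q, Relation.ReflTransGen (G.Follows τ) p q → G.owner q = .defender → G.Move q (τ q)) ∧
    ∀ w : ℕ → G.Pos, w 0 = p → (∀ n, G.Follows τ (w n) (w (n + 1))) → G.DefenderWinsPlay w

/-- Defender has a winning (positional) strategy from `p`. -/
def DefenderWins (p : G.Pos) : Prop :=
  ∃ τ, G.IsWinningStrategy τ p

end ParityGame

/-! ## The parity game of a formula -/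

section Game

variable {A : Type u} {S : Type v} {L : Type w} {T : Type t} [DecidableEq A]
    [NominalSet A S] [NominalSet A L]

/-- Positions `(s, H, ξ, φ)`. -/
structure Position (A : Type u) (S : Type v) (T : Type t) [NominalSet A S] where
  conf : Conf A S
  val : Valuation A S
  form : Formula A T

open Classical in
/-- The player who moves at a position. At an atomic formula there is no move, and the position is
assigned to the player who loses there. -/
noncomputable def Position.owner (p : Position A S T) : Player :=
  match p.form with
  | .eq u v => if u = v then .attacker else .defender
  | .ne u v => if u = v then .defender else .attacker
  | .rvar X us =>
      if ∃ as, us = Term.name ∘ as ∧ p.conf ∈ p.val X as then .attacker else .defender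
  | .or _ _ | .bigOr _ _ | .fresh _ _ | .dia _ _ _ | .fix _ _ _ _ _ | .neg _ => .defender
  | .and _ _ | .bigAnd _ _ | .freshAll _ _ | .box _ _ _ => .attacker

/-- The moves of the game. There are none for negations, which the game does not treat. -/
inductive FLTS.GameMove (𝓛 : FLTS A S L) (act : ActionTerms A T L) :
    Position A S T → Position A S T → Prop
  | or_left (c ξ φ₁ φ₂) : GameMove 𝓛 act ⟨c, ξ, .or φ₁ φ₂⟩ ⟨c, ξ, φ₁⟩
  | or_right (c ξ φ₁ φ₂) : GameMove 𝓛 act ⟨c, ξ, .or φ₁ φ₂⟩ ⟨c, ξ, φ₂⟩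
  | and_left (c ξ φ₁ φ₂) : GameMove 𝓛 act ⟨c, ξ, .and φ₁ φ₂⟩ ⟨c, ξ, φ₁⟩
  | and_right (c ξ φ₁ φ₂) : GameMove 𝓛 act ⟨c, ξ, .and φ₁ φ₂⟩ ⟨c, ξ, φ₂⟩
  | bigOr (c ξ x φ a) : GameMove 𝓛 act ⟨c, ξ, .bigOr x φ⟩ ⟨c, ξ, φ.inst1 x a⟩
  | bigAnd (c ξ x φ a) : GameMove 𝓛 act ⟨c, ξ, .bigAnd x φ⟩ ⟨c, ξ, φ.inst1 x a⟩
  | fresh (c ξ x φ a) (ha : a ∉ c.hist) :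
      GameMove 𝓛 act ⟨c, ξ, .fresh x φ⟩ ⟨c, ξ, φ.inst1 x a⟩
  | freshAll (c ξ x φ a) (ha : a ∉ c.hist) :
      GameMove 𝓛 act ⟨c, ξ, .freshAll x φ⟩ ⟨c, ξ, φ.inst1 x a⟩
  | dia (c c' ξ t us φ) (h : 𝓛.Step act t us c c') :
      GameMove 𝓛 act ⟨c, ξ, .dia t us φ⟩ ⟨c', ξ, φ⟩
  | box (c c' ξ t us φ) (h : 𝓛.Step act t us c c') :
      GameMove 𝓛 act ⟨c, ξ, .box t us φ⟩ ⟨c', ξ, φ⟩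
  | fix (c ξ σ X xs φ as) :
      GameMove 𝓛 act ⟨c, ξ, .fix σ X xs φ (Term.name ∘ as)⟩ ⟨c, ξ, φ.unfold σ X xs as⟩

/-- The rank of a position: that of the recursion variable at a fixpoint formula, else zero. -/
def Position.rank (Ω : RVar → ℕ) (p : Position A S T) : ℕ :=
  match p.form with
  | .fix _ X _ _ _ => Ω X
  | _ => 0

/-- The parity game on positions `(s, H, ξ, φ)`, with the ranking `Ω` of recursion variables. -/
noncomputable def FLTS.game (𝓛 : FLTS A S L) (act : ActionTerms A T L) (Ω : RVar → ℕ) :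
    ParityGame.{max u v t} where
  Pos := Position A S T
  owner := Position.owner
  Move := 𝓛.GameMove act
  rank := Position.rank Ω

end Game

end FHML

/-! Induction on the size of the formula, for all valuations at once. Away from fixpoint operators,
the denotation and Defender's winning region obey the same equations: a Defender position is won iff
some move leads to a won position, an Attacker position iff all moves do. For positional strategies
these equations rest on `exists_uniform_strategy`, which provides one strategy that wins wherever
Defender can win.

Unfolding `(σX(xs).φ)(us)` does not shrink the formula, so the induction hypothesis is applied to
instances of the body `φ`, with `X` free and interpreted by an arbitrary `f`. The game of the body
stops at `X(us)`, and `f` decides who wins there. Substituting `σX(xs).φ` for `X` embeds it into the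
game of the fixpoint formula, where the play goes on; `ParityGame.Unfolding` is the abstract form of
this embedding.

Let `g` be Defender's winning region at the fixpoint formula. For `μ`, `g` is a prefixpoint
(`defenderWins_map`). It lies below every prefixpoint `f`: the rank of `X` is odd and dominates all
ranks between two returns to `X`, so plays of a winning strategy return finitely often, and
induction along the returns applies (`sink_induction_of_odd`, `defenderWins_of_map`). For `ν`, `g`
is a postfixpoint (`defenderWins_of_map`). It lies above every postfixpoint, since returning to `X`
forever is now won by Defender (`defenderWins_map_of_even`). As the denotations are an infimum of
prefixpoints and a supremum of postfixpoints, monotonicity of the body is not needed; nor are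
strategies of Attacker. -/

namespace FHML

/-! ### Positional winning strategies in parity games -/

namespace ParityGame

universe u

/-- Paths from `s` back to `s` are concatenated. Carrying the number of steps left until `s` turns
the construction into the iteration of one function. -/
theorem exists_path_frequently {α : Type u} {r : α → α → Prop} {s : Set α}
    (h : ∀ a ∈ s, ∃ b ∈ s, Relation.TransGen r a b) {a : α} (ha : a ∈ s) :
    ∃ w : ℕ → α, w 0 = a ∧ (∀ n, r (w n) (w (n + 1))) ∧ ∃ᶠ n in Filter.atTop, w n ∈ s := by
  -- `reach n a`: some path of length `n` leads from `a` into `s`.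
  let reach : ℕ → α → Prop := fun n => Nat.rec (fun a => a ∈ s) (fun _ R a => ∃ b, r a b ∧ R b) n
  have hreach : ∀ a b, Relation.ReflTransGen r a b → b ∈ s → ∃ n, reach n a := by
    intro a b hab hb
    induction hab using Relation.ReflTransGen.head_induction_on with
    | refl => exact ⟨0, hb⟩
    | head hac _ ih =>
      obtain ⟨n, hn⟩ := ih
      exact ⟨n + 1, _, hac, hn⟩
  -- The counter drops by one at each step. At zero the position is in `s`; a new path is chosen and
  -- its first step taken at once, which exists because the path is nonempty.
  have hnext : ∀ x : {x : ℕ × α // reach x.1 x.2}, ∃ y : {x : ℕ × α // reach x.1 x.2},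
      r x.1.2 y.1.2 ∧ (x.1.1 = 0 ∨ y.1.1 + 1 = x.1.1) := by
    rintro ⟨⟨n, p⟩, hp⟩
    cases n with
    | zero =>
      obtain ⟨b, hb, hpb⟩ := h p hp
      obtain ⟨c, hpc, hcb⟩ := Relation.TransGen.head'_iff.mp hpb
      obtain ⟨n, hn⟩ := hreach c b hcb hb
      exact ⟨⟨(n, c), hn⟩, hpc, .inl rfl⟩
    | succ n =>
      obtain ⟨b, hpb, hb⟩ := hp
      exact ⟨⟨(n, b), hb⟩, hpb, .inr rfl⟩
  choose next hr hn using hnext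
  let x : ℕ → {x : ℕ × α // reach x.1 x.2} := fun n => next^[n] ⟨(0, a), ha⟩
  have hx : ∀ n, x (n + 1) = next (x n) := fun n => Function.iterate_succ_apply' _ _ _
  refine ⟨fun n => (x n).1.2, rfl, fun n => (hx n ▸ hr (x n) : r (x n).1.2 (x (n + 1)).1.2), ?_⟩
  have key : ∀ k n, (x n).1.1 = k → ∃ m, n ≤ m ∧ (x m).1.2 ∈ s := by
    intro k
    induction k with
    | zero =>
      intro n hk
      have := (x n).2
      rw [hk] at this
      exact ⟨n, le_rfl, this⟩
    | succ k ih =>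
      intro n hk
      have h1 := (hn (x n)).resolve_left (by omega)
      rw [← hx] at h1
      obtain ⟨m, hm, hs⟩ := ih (n + 1) (by omega)
      exact ⟨m, by omega, hs⟩
  exact Filter.frequently_atTop.mpr fun n => key _ n rfl

variable {G : ParityGame.{u}}

theorem DefenderWinsPlay.congr {w w' : ℕ → G.Pos} (hw : G.DefenderWinsPlay w)
    (h : ∀ᶠ n in Filter.atTop, G.rank (w' n) = G.rank (w n)) : G.DefenderWinsPlay w' := by
  obtain ⟨d, hd, h1, h2⟩ := hw
  exact ⟨d, hd, (h1.and_eventually h).mono fun n hn => hn.2.trans hn.1,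
    (h2.and h).mono fun n hn => hn.2.le.trans hn.1⟩

theorem defenderWinsPlay_shift {w : ℕ → G.Pos} (k : ℕ) :
    G.DefenderWinsPlay (fun n => w (n + k)) ↔ G.DefenderWinsPlay w := by
  unfold DefenderWinsPlay
  conv_rhs => rw [← Filter.map_add_atTop_eq_nat k]
  simp only [Filter.frequently_map, Filter.eventually_map]

theorem IsWinningStrategy.of_follows {τ : G.Pos → G.Pos} {p q : G.Pos}
    (h : G.IsWinningStrategy τ p) (hpq : G.Follows τ p q) : G.IsWinningStrategy τ q := by
  refine ⟨fun r hr => h.1 r (.head hpq hr), fun w hw hf => ?_⟩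
  have := h.2 (fun n => Nat.casesOn n p w) rfl (by
    rintro (_ | n)
    · simpa [hw] using hpq
    · exact hf n)
  exact (defenderWinsPlay_shift 1).mpr this

theorem IsWinningStrategy.of_reflTransGen {τ : G.Pos → G.Pos} {p q : G.Pos}
    (h : G.IsWinningStrategy τ p) (hpq : Relation.ReflTransGen (G.Follows τ) p q) :
    G.IsWinningStrategy τ q := by
  induction hpq with
  | refl => exact h
  | tail _ hf ih => exact ih.of_follows hf

theorem IsWinningStrategy.move {τ : G.Pos → G.Pos} {p : G.Pos}
    (h : G.IsWinningStrategy τ p) (hp : G.owner p = .defender) : G.Move p (τ p) :=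
  h.1 p .refl hp

theorem isWinningStrategy_of_invariant {τ : G.Pos → G.Pos} {U : Set G.Pos}
    (hmove : ∀ q ∈ U, G.owner q = .defender → G.Move q (τ q))
    (hstep : ∀ q ∈ U, ∀ q', G.Follows τ q q' → q' ∈ U)
    (hplay : ∀ w : ℕ → G.Pos, (∀ n, w n ∈ U) → (∀ n, G.Follows τ (w n) (w (n + 1))) →
      G.DefenderWinsPlay w) {p : G.Pos} (hp : p ∈ U) : G.IsWinningStrategy τ p := by
  refine ⟨fun q hq => hmove q ?_, fun w hw hf => hplay w (fun n => ?_) hf⟩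
  · induction hq with
    | refl => exact hp
    | tail _ hf ih => exact hstep _ ih _ hf
  · induction n with
    | zero => exact hw ▸ hp
    | succ n ih => exact hstep _ ih _ (hf n)

/-- A single positional strategy wins from all positions from which Defender wins. -/
theorem exists_uniform_strategy (G : ParityGame.{u}) :
    ∃ τ, ∀ p, G.DefenderWins p → G.IsWinningStrategy τ p := by
  classical
  let _ : LinearOrder (G.Pos → G.Pos) := IsWellOrder.linearOrder WellOrderingRel
  have wf : WellFounded ((· < ·) : (G.Pos → G.Pos) → (G.Pos → G.Pos) → Prop) :=
    (inferInstance : IsWellFounded (G.Pos → G.Pos) WellOrderingRel).wf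
  -- `m p` is the least strategy, in a well-order of all strategies, that wins from `p`; the uniform
  -- strategy plays `m p` at `p`. A strategy that wins from a position also wins from the positions
  -- it leads to, so `m` never increases along a play. Hence it is eventually constant, and from
  -- then on the play follows a single winning strategy.
  let m : G.Pos → G.Pos → G.Pos := fun p =>
    if h : G.DefenderWins p then wf.min {τ | G.IsWinningStrategy τ p} h else id
  have hm : ∀ p, G.DefenderWins p → G.IsWinningStrategy (m p) p := by
    intro p hp
    simp only [m, dif_pos hp]
    exact wf.min_mem {τ | G.IsWinningStrategy τ p} hp
  have hle : ∀ p τ, G.IsWinningStrategy τ p → m p ≤ τ := by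
    intro p τ hp
    have hp' : G.DefenderWins p := ⟨τ, hp⟩
    simp only [m, dif_pos hp']
    exact not_lt.mp (wf.not_lt_min {τ | G.IsWinningStrategy τ p} hp)
  refine ⟨fun p => m p p, fun p hp => ?_⟩
  have hfol : ∀ q q', G.Follows (fun p => m p p) q q' → G.Follows (m q) q q' := fun q q' h => h
  refine isWinningStrategy_of_invariant (U := {q | G.DefenderWins q})
    (fun q hq ho => (hm q hq).move ho) (fun q hq q' hf => ⟨_, (hm q hq).of_follows (hfol _ _ hf)⟩)
    (fun w hw hf => ?_) hp
  have hanti : ∀ n, m (w (n + 1)) ≤ m (w n) := fun n =>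
    hle _ _ ((hm _ (hw n)).of_follows (hfol _ _ (hf n)))
  have hanti' : Antitone fun n => m (w n) := antitone_nat_of_succ_le hanti
  obtain ⟨N, hN⟩ : ∃ N, ∀ n, m (w N) ≤ m (w n) := by
    obtain ⟨_, ⟨N, rfl⟩, hN⟩ := wf.has_min (Set.range fun n => m (w n)) ⟨_, 0, rfl⟩
    exact ⟨N, fun n => not_lt.mp (hN _ ⟨n, rfl⟩)⟩
  rw [← defenderWinsPlay_shift N]
  refine (hm _ (hw N)).2 _ (by simp) fun n => ?_
  have h1 : m (w (n + N)) = m (w N) := le_antisymm (hanti' (by omega)) (hN _)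
  have h2 := hfol _ _ (hf (n + N))
  rw [h1] at h2
  rwa [Nat.add_right_comm]

theorem defenderWins_of_follows {τ : G.Pos → G.Pos} (hτ : ∀ p, G.DefenderWins p →
    G.IsWinningStrategy τ p) {p q : G.Pos} (hp : G.DefenderWins p) (h : G.Follows τ p q) :
    G.DefenderWins q :=
  ⟨τ, (hτ p hp).of_follows h⟩

theorem defenderWins_iff_of_defender {p : G.Pos} (hp : G.owner p = .defender) :
    G.DefenderWins p ↔ ∃ q, G.Move p q ∧ G.DefenderWins q := by
  classical
  obtain ⟨τ, hτ⟩ := G.exists_uniform_strategy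
  constructor
  · intro h
    exact ⟨τ p, (hτ p h).move hp, defenderWins_of_follows hτ h ⟨(hτ p h).move hp, fun _ => rfl⟩⟩
  · rintro ⟨q, hpq, hq⟩
    -- If `p` were not won, then `τ` could be redirected at `p` to `q` without changing it on the
    -- winning region, which plays following `τ` never leave.
    by_contra hn
    refine hn ⟨Function.update τ p q, ?_⟩
    have hne : ∀ r, G.DefenderWins r → Function.update τ p q r = τ r := by
      intro r hr
      exact Function.update_of_ne (by rintro rfl; exact hn hr) _ _
    have hfol : ∀ r, G.DefenderWins r → ∀ r', G.Follows (Function.update τ p q) r r' →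
        G.Follows τ r r' := fun r hr r' h => ⟨h.1, fun ho => by rw [h.2 ho, hne r hr]⟩
    have hq' : G.IsWinningStrategy (Function.update τ p q) q := by
      refine isWinningStrategy_of_invariant (U := {r | G.DefenderWins r})
        (fun r hr ho => by rw [hne r hr]; exact (hτ r hr).move ho)
        (fun r hr r' h => defenderWins_of_follows hτ hr (hfol r hr r' h))
        (fun w hw hf => (hτ _ (hw 0)).2 w rfl fun n => hfol _ (hw n) _ (hf n)) hq
    refine isWinningStrategy_of_invariant
      (U := {r | r = p ∨ G.IsWinningStrategy (Function.update τ p q) r}) ?_ ?_ ?_ (.inl rfl)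
    · rintro r (rfl | hr) ho
      · simpa using hpq
      · exact hr.move ho
    · rintro r (rfl | hr) r' h
      · rw [h.2 hp, Function.update_self]
        exact .inr hq'
      · exact .inr (hr.of_follows h)
    · intro w hw hf
      rw [← defenderWinsPlay_shift 1]
      suffices h1 : G.IsWinningStrategy (Function.update τ p q) (w 1) from
        h1.2 _ rfl fun n => hf (n + 1)
      rcases hw 0 with h0 | h0
      · have := (hf 0).2 (h0 ▸ hp)
        rw [h0, Function.update_self] at this
        rwa [this]
      · exact h0.of_follows (hf 0)

theorem defenderWins_iff_of_attacker {p : G.Pos} (hp : G.owner p = .attacker) :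
    G.DefenderWins p ↔ ∀ q, G.Move p q → G.DefenderWins q := by
  obtain ⟨τ, hτ⟩ := G.exists_uniform_strategy
  constructor
  · intro h q hq
    exact defenderWins_of_follows hτ h ⟨hq, fun h' => by simp [hp] at h'⟩
  · intro h
    refine ⟨τ, isWinningStrategy_of_invariant (U := {r | r = p ∨ G.DefenderWins r})
      ?_ ?_ ?_ (.inl rfl)⟩
    · rintro r (rfl | hr) ho
      · simp [hp] at ho
      · exact (hτ r hr).move ho
    · rintro r (rfl | hr) r' h'
      · exact .inr (h _ h'.1)
      · exact .inr (defenderWins_of_follows hτ hr h')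
    · intro w hw hf
      rw [← defenderWinsPlay_shift 1]
      refine (hτ _ ?_).2 _ rfl fun n => hf (n + 1)
      rcases hw 0 with h0 | h0
      · exact h _ (h0 ▸ (hf 0).1)
      · exact defenderWins_of_follows hτ h0 (hf 0)

theorem defenderWins_iff_of_no_move {p : G.Pos} (hp : ∀ q, ¬ G.Move p q) :
    G.DefenderWins p ↔ G.owner p = .attacker := by
  cases ho : G.owner p with
  | defender => simp [defenderWins_iff_of_defender ho, hp]
  | attacker => simp [defenderWins_iff_of_attacker ho, hp]

/-! ### Unfolding a parity game at its sinks -/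

/-- A part `dom` of a parity game, closed under moves, and a copy of it within the game in which the
play goes on at the positions in `sink`, where it ends in `dom`. In the copy, the positions in `sink`
have rank `d`, and the ranks of the positions from which `sink` can be reached are at most `d`. -/
structure Unfolding (G : ParityGame.{u}) where
  dom : Set G.Pos
  sink : Set G.Pos
  live : Set G.Pos
  map : G.Pos → G.Pos
  d : ℕ
  injOn : Set.InjOn map dom
  move_mem : ∀ q ∈ dom, ∀ q', G.Move q q' → q' ∈ dom
  not_move_of_sink : ∀ q ∈ sink, ∀ q', ¬ G.Move q q'
  owner_map : ∀ q ∈ dom, q ∉ sink → G.owner (map q) = G.owner q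
  rank_map : ∀ q ∈ dom, q ∉ sink → G.rank (map q) = G.rank q
  move_map : ∀ q ∈ dom, q ∉ sink → ∀ p, G.Move (map q) p ↔ ∃ q', G.Move q q' ∧ map q' = p
  owner_map_of_sink : ∀ q ∈ sink, G.owner (map q) = .defender
  move_map_of_sink : ∀ q ∈ dom, q ∈ sink → ∀ p, G.Move (map q) p → p ∈ map '' dom
  rank_map_of_sink : ∀ q ∈ sink, G.rank (map q) = d
  sink_subset_live : sink ⊆ live
  live_of_move : ∀ q ∈ dom, ∀ q', G.Move q q' → q' ∈ live → q ∈ live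
  rank_map_le : ∀ q ∈ dom, q ∈ live → G.rank (map q) ≤ d

namespace Unfolding

variable (E : G.Unfolding)

theorem move_of_move_map {q q' : G.Pos} (hq : q ∈ E.dom) (hs : q ∉ E.sink) (hq' : q' ∈ E.dom)
    (h : G.Move (E.map q) (E.map q')) : G.Move q q' := by
  obtain ⟨r, hr, he⟩ := (E.move_map q hq hs _).mp h
  rwa [E.injOn hq' (E.move_mem q hq r hr) he.symm]

theorem move_map_mem {q p : G.Pos} (hq : q ∈ E.dom) (h : G.Move (E.map q) p) :
    p ∈ E.map '' E.dom := by
  by_cases hs : q ∈ E.sink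
  · exact E.move_map_of_sink q hq hs p h
  · obtain ⟨r, hr, rfl⟩ := (E.move_map q hq hs _).mp h
    exact ⟨r, E.move_mem q hq r hr, rfl⟩

/-- If sinks recur, then every position of the play has a sink ahead of it and is live, so its rank
is at most `d`, and `d` recurs at the sinks. The parity of `d` thus decides the play. -/
theorem rank_of_frequently_sink {v : ℕ → G.Pos} (hv : ∀ n, v n ∈ E.dom)
    (hm : ∀ n, G.Move (E.map (v n)) (E.map (v (n + 1))))
    (hs : ∃ᶠ n in Filter.atTop, v n ∈ E.sink) :
    (∃ᶠ n in Filter.atTop, G.rank (E.map (v n)) = E.d) ∧ ∀ n, G.rank (E.map (v n)) ≤ E.d := by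
  refine ⟨hs.mono fun n h => E.rank_map_of_sink _ h, fun n => E.rank_map_le _ (hv n) ?_⟩
  have key : ∀ k n, v (n + k) ∈ E.sink → v n ∈ E.live := by
    intro k
    induction k with
    | zero => exact fun n h => E.sink_subset_live h
    | succ k ih =>
      intro n h
      by_cases hn : v n ∈ E.sink
      · exact E.sink_subset_live hn
      · exact E.live_of_move _ (hv n) _ (E.move_of_move_map (hv n) hn (hv _) (hm n))
          (ih (n + 1) (by rwa [Nat.add_right_comm]))
  obtain ⟨m, hnm, h⟩ := Filter.frequently_atTop.mp hs n
  exact key (m - n) n (by rwa [Nat.add_sub_cancel' hnm])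

theorem exists_preimage {w : ℕ → G.Pos} {P : G.Pos → Prop}
    (h : ∀ n, ∃ q ∈ E.dom, P q ∧ E.map q = w n) :
    ∃ v : ℕ → G.Pos, (∀ n, v n ∈ E.dom) ∧ (∀ n, P (v n)) ∧ ∀ n, E.map (v n) = w n := by
  choose v h1 h2 h3 using h
  exact ⟨v, h1, h2, h3⟩

theorem exists_leftInverse : ∃ inv : G.Pos → G.Pos, ∀ q ∈ E.dom, inv (E.map q) = q := by
  by_cases h : Nonempty G.Pos
  · exact ⟨Function.invFunOn E.map E.dom, E.injOn.leftInvOn_invFunOn⟩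
  · exact ⟨id, fun q => (h ⟨q⟩).elim⟩

/-- Defender copies the original strategy until the image position is itself won in the game, and
then switches to the uniform strategy for good. By `h` the image of a won sink is such a position,
so no sink is met before the switch, and up to there the ranks agree. -/
theorem defenderWins_map (h : ∀ q ∈ E.dom, q ∈ E.sink → G.DefenderWins q →
    G.DefenderWins (E.map q)) {q : G.Pos} (hq : q ∈ E.dom) (hw : G.DefenderWins q) :
    G.DefenderWins (E.map q) := by
  classical
  obtain ⟨τ, hτ⟩ := G.exists_uniform_strategy
  obtain ⟨inv, hinv⟩ := E.exists_leftInverse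
  let ρ : G.Pos → G.Pos := fun p => if G.DefenderWins p then τ p else E.map (τ (inv p))
  have hρ : ∀ p, G.DefenderWins p → ∀ p', G.Follows ρ p p' → G.Follows τ p p' :=
    fun p hp p' hf => ⟨hf.1, fun ho => by rw [hf.2 ho]; exact if_pos hp⟩
  have hρ' : ∀ r ∈ E.dom, ¬ G.DefenderWins (E.map r) → ρ (E.map r) = E.map (τ r) := by
    intro r hr hn
    simp only [ρ, if_neg hn, hinv r hr]
  have hback : ∀ r ∈ E.dom, G.DefenderWins r → ¬ G.DefenderWins (E.map r) →
      ∀ p', G.Follows ρ (E.map r) p' → ∃ r', G.Follows τ r r' ∧ E.map r' = p' := by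
    intro r hr hwr hn p' hf
    have hs : r ∉ E.sink := fun hs => hn (h r hr hs hwr)
    cases ho : G.owner r with
    | defender =>
      have := hf.2 ((E.owner_map r hr hs).trans ho)
      exact ⟨τ r, ⟨(hτ r hwr).move ho, fun _ => rfl⟩, by rw [this, hρ' r hr hn]⟩
    | attacker =>
      obtain ⟨r', h1, h2⟩ := (E.move_map r hr hs _).mp hf.1
      exact ⟨r', ⟨h1, fun h' => by simp [ho] at h'⟩, h2⟩
  refine ⟨ρ, isWinningStrategy_of_invariant
    (U := {p | G.DefenderWins p ∨ ∃ r ∈ E.dom, G.DefenderWins r ∧ E.map r = p})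
    ?_ ?_ ?_ (.inr ⟨q, hq, hw, rfl⟩)⟩
  · intro p hp ho
    by_cases hn : G.DefenderWins p
    · simp only [ρ, if_pos hn]
      exact (hτ p hn).move ho
    · obtain ⟨r, hr, hwr, rfl⟩ := hp.resolve_left hn
      have hs : r ∉ E.sink := fun hs => hn (h r hr hs hwr)
      rw [hρ' r hr hn]
      exact (E.move_map r hr hs _).mpr ⟨_, (hτ r hwr).move ((E.owner_map r hr hs).symm.trans ho), rfl⟩
  · intro p hp p' hf
    by_cases hn : G.DefenderWins p
    · exact .inl (defenderWins_of_follows hτ hn (hρ p hn p' hf))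
    · obtain ⟨r, hr, hwr, rfl⟩ := hp.resolve_left hn
      obtain ⟨r', hf', rfl⟩ := hback r hr hwr hn p' hf
      exact .inr ⟨r', E.move_mem r hr _ hf'.1, defenderWins_of_follows hτ hwr hf', rfl⟩
  · intro w hU hf
    by_cases hn : ∃ N, G.DefenderWins (w N)
    · obtain ⟨N, hN⟩ := hn
      have hall : ∀ n, G.DefenderWins (w (n + N)) := by
        intro n
        induction n with
        | zero => simpa using hN
        | succ n ih =>
          have := defenderWins_of_follows hτ ih (hρ _ ih _ (hf (n + N)))
          rwa [Nat.add_right_comm] at this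
      rw [← defenderWinsPlay_shift N]
      refine (hτ _ hN).2 _ (by simp) fun n => ?_
      have := hρ _ (hall n) _ (hf (n + N))
      rwa [Nat.add_right_comm] at this
    · push Not at hn
      obtain ⟨v, hv, hwv, hvw⟩ := E.exists_preimage fun n => (hU n).resolve_left (hn n)
      have hs : ∀ n, v n ∉ E.sink := fun n hs => hn n (hvw n ▸ h _ (hv n) hs (hwv n))
      have hplay := (hτ _ (hwv 0)).2 v rfl fun n => by
        obtain ⟨r', h1, h2⟩ := hback _ (hv n) (hwv n) (by rw [hvw]; exact hn n) (w (n + 1))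
          (by rw [hvw]; exact hf n)
        rwa [E.injOn (hv (n + 1)) (E.move_mem _ (hv n) _ h1.1) ((hvw _).trans h2.symm)]
      refine hplay.congr (.of_forall fun n => ?_)
      rw [← hvw n, E.rank_map _ (hv n) (hs n)]

/-- Defender copies the original strategy and, at a sink, re-enters the copy at a won position. With
infinitely many re-entries the greatest recurring rank is the even `d`; with finitely many, a tail
of the play is the copy of a won play. -/
theorem defenderWins_map_of_even (hd : Even E.d) (h : ∀ q ∈ E.dom, q ∈ E.sink → G.DefenderWins q →
    ∃ q' ∈ E.dom, G.DefenderWins q' ∧ G.Move (E.map q) (E.map q')) {q : G.Pos} (hq : q ∈ E.dom)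
    (hw : G.DefenderWins q) : G.DefenderWins (E.map q) := by
  classical
  obtain ⟨τ, hτ⟩ := G.exists_uniform_strategy
  obtain ⟨inv, hinv⟩ := E.exists_leftInverse
  choose! next hnd hnw hnm using h
  let ρ : G.Pos → G.Pos := fun p =>
    if inv p ∈ E.sink then E.map (next (inv p)) else E.map (τ (inv p))
  have hρ : ∀ r ∈ E.dom, r ∈ E.sink → ρ (E.map r) = E.map (next r) := by
    intro r hr hs
    simp only [ρ, hinv r hr, if_pos hs]
  have hρ' : ∀ r ∈ E.dom, r ∉ E.sink → ρ (E.map r) = E.map (τ r) := by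
    intro r hr hs
    simp only [ρ, hinv r hr, if_neg hs]
  have hback : ∀ r ∈ E.dom, G.DefenderWins r → r ∉ E.sink →
      ∀ p', G.Follows ρ (E.map r) p' → ∃ r', G.Follows τ r r' ∧ E.map r' = p' := by
    intro r hr hwr hs p' hf
    cases ho : G.owner r with
    | defender =>
      have := hf.2 ((E.owner_map r hr hs).trans ho)
      exact ⟨τ r, ⟨(hτ r hwr).move ho, fun _ => rfl⟩, by rw [this, hρ' r hr hs]⟩
    | attacker =>
      obtain ⟨r', h1, h2⟩ := (E.move_map r hr hs _).mp hf.1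
      exact ⟨r', ⟨h1, fun h' => by simp [ho] at h'⟩, h2⟩
  refine ⟨ρ, isWinningStrategy_of_invariant
    (U := {p | ∃ r ∈ E.dom, G.DefenderWins r ∧ E.map r = p}) ?_ ?_ ?_ ⟨q, hq, hw, rfl⟩⟩
  · rintro _ ⟨r, hr, hwr, rfl⟩ ho
    by_cases hs : r ∈ E.sink
    · rw [hρ r hr hs]
      exact hnm r hr hs hwr
    · rw [hρ' r hr hs]
      exact (E.move_map r hr hs _).mpr ⟨_, (hτ r hwr).move ((E.owner_map r hr hs).symm.trans ho), rfl⟩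
  · rintro _ ⟨r, hr, hwr, rfl⟩ p' hf
    by_cases hs : r ∈ E.sink
    · rw [hf.2 (E.owner_map_of_sink r hs), hρ r hr hs]
      exact ⟨_, hnd r hr hs hwr, hnw r hr hs hwr, rfl⟩
    · obtain ⟨r', hf', rfl⟩ := hback r hr hwr hs p' hf
      exact ⟨r', E.move_mem r hr _ hf'.1, defenderWins_of_follows hτ hwr hf', rfl⟩
  · intro w hU hf
    obtain ⟨v, hv, hwv, hvw⟩ := E.exists_preimage hU
    obtain rfl : (fun n => E.map (v n)) = w := funext hvw
    by_cases hs : ∃ᶠ n in Filter.atTop, v n ∈ E.sink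
    · obtain ⟨h1, h2⟩ := E.rank_of_frequently_sink hv (fun n => (hf n).1) hs
      exact ⟨E.d, hd, h1, .of_forall h2⟩
    · obtain ⟨N, hN⟩ := Filter.eventually_atTop.mp (Filter.not_frequently.mp hs)
      rw [← defenderWinsPlay_shift N]
      have hplay := (hτ _ (hwv N)).2 (fun n => v (n + N)) (by simp) fun n => by
        obtain ⟨r', h1, h2⟩ := hback _ (hv (n + N)) (hwv _) (hN _ (by omega)) _ (hf (n + N))
        rw [Nat.add_right_comm]
        rwa [E.injOn (hv _) (E.move_mem _ (hv _) _ h1.1) h2.symm]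
      exact hplay.congr (.of_forall fun n => E.rank_map _ (hv _) (hN _ (by omega)))

/-- The strategy is pulled back along the injective `map`. Infinite original plays avoid sinks,
which have no moves, and so have the ranks of their images. A play that ends in a sink leaves
Attacker stuck, by `h`. -/
theorem defenderWins_of_map {τ : G.Pos → G.Pos} {q : G.Pos} (hq : q ∈ E.dom)
    (hτ : G.IsWinningStrategy τ (E.map q))
    (h : ∀ t ∈ E.dom, t ∈ E.sink → Relation.ReflTransGen (G.Follows τ) (E.map q) (E.map t) →
      G.owner t = .attacker) : G.DefenderWins q := by
  obtain ⟨inv, hinv⟩ := E.exists_leftInverse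
  have hfol : ∀ t ∈ E.dom, ∀ t', G.Follows (fun t => inv (τ (E.map t))) t t' →
      Relation.ReflTransGen (G.Follows τ) (E.map q) (E.map t) →
      G.Follows τ (E.map t) (E.map t') := by
    intro t ht t' hf hr
    have hs : t ∉ E.sink := fun hs => E.not_move_of_sink t hs _ hf.1
    refine ⟨(E.move_map t ht hs _).mpr ⟨t', hf.1, rfl⟩, fun ho => ?_⟩
    obtain ⟨r, hr, hr'⟩ := E.move_map_mem ht ((hτ.of_reflTransGen hr).move ho)
    rw [hf.2 ((E.owner_map t ht hs).symm.trans ho), ← hr']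
    simp only [← hr', hinv r hr]
  refine ⟨fun t => inv (τ (E.map t)), isWinningStrategy_of_invariant
    (U := {t | t ∈ E.dom ∧ Relation.ReflTransGen (G.Follows τ) (E.map q) (E.map t)})
    ?_ ?_ ?_ ⟨hq, .refl⟩⟩
  · rintro t ⟨ht, hr⟩ ho
    have hs : t ∉ E.sink := fun hs => by simp [h t ht hs hr] at ho
    obtain ⟨t', h1, h2⟩ := (E.move_map t ht hs _).mp
      ((hτ.of_reflTransGen hr).move ((E.owner_map t ht hs).trans ho))
    rwa [← h2, hinv t' (E.move_mem t ht _ h1)]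
  · rintro t ⟨ht, hr⟩ t' hf
    exact ⟨E.move_mem t ht _ hf.1, hr.tail (hfol t ht t' hf hr)⟩
  · intro w hU hf
    have hs : ∀ n, w n ∉ E.sink := fun n hs => E.not_move_of_sink _ hs _ (hf n).1
    refine DefenderWinsPlay.congr ((hτ.of_reflTransGen (hU 0).2).2 (fun n => E.map (w n)) rfl
      fun n => hfol _ (hU n).1 _ (hf n) (hU n).2) (.of_forall fun n => ?_)
    exact (E.rank_map _ (hU n).1 (hs n)).symm

/-- Under a winning strategy, reachability between sinks is well-founded: if `P` failed at a sink,
each failing sink would lead to another, and the resulting play would have the odd `d` as its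
greatest recurring rank. -/
theorem sink_induction_of_odd (hd : Odd E.d) {τ : G.Pos → G.Pos} {P : G.Pos → Prop}
    (h : ∀ t ∈ E.dom, t ∈ E.sink → G.IsWinningStrategy τ (E.map t) →
      (∀ t' ∈ E.dom, t' ∈ E.sink → Relation.TransGen (G.Follows τ) (E.map t) (E.map t') → P t') →
      P t) {t : G.Pos} (ht : t ∈ E.dom) (hs : t ∈ E.sink) (hw : G.IsWinningStrategy τ (E.map t)) :
    P t := by
  by_contra hP
  obtain ⟨w, hw0, hf, hfr⟩ := exists_path_frequently (r := G.Follows τ)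
    (s := {p | ∃ t ∈ E.dom, t ∈ E.sink ∧ G.IsWinningStrategy τ (E.map t) ∧ ¬ P t ∧ E.map t = p})
    (by
      rintro _ ⟨t, ht, hs, hw, hP, rfl⟩
      by_contra hn
      push Not at hn
      refine hP (h t ht hs hw fun t' ht' hs' htr => ?_)
      by_contra hP'
      exact hn _ ⟨t', ht', hs', hw.of_reflTransGen htr.to_reflTransGen, hP', rfl⟩ htr)
    ⟨t, ht, hs, hw, hP, rfl⟩
  have hdom : ∀ n, ∃ q ∈ E.dom, True ∧ E.map q = w n := by
    intro n
    induction n with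
    | zero => exact ⟨t, ht, trivial, hw0.symm⟩
    | succ n ih =>
      obtain ⟨q, hq, -, hqw⟩ := ih
      obtain ⟨r, hr, hrw⟩ := E.move_map_mem hq (hqw ▸ (hf n).1)
      exact ⟨r, hr, trivial, hrw⟩
  obtain ⟨v, hv, -, hvw⟩ := E.exists_preimage hdom
  obtain rfl : (fun n => E.map (v n)) = w := funext hvw
  obtain ⟨h1, h2⟩ := E.rank_of_frequently_sink hv (fun n => (hf n).1) (hfr.mono (by
    rintro n ⟨r, hr, hs, -, -, hrv⟩
    rwa [E.injOn (hv n) hr hrv.symm]))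
  obtain ⟨d, hd', h3, h4⟩ := hw.2 _ hw0 hf
  obtain ⟨n, hn⟩ := h3.exists
  obtain ⟨m, hm1, hm2⟩ := (h1.and_eventually h4).exists
  -- Each of `d` and `E.d` recurs and eventually bounds all ranks, so they coincide.
  have : d = E.d := le_antisymm (hn ▸ h2 n) (hm1 ▸ hm2)
  exact Nat.not_even_iff_odd.mpr hd (this ▸ hd')

end Unfolding

end ParityGame

end FHML

/-! ### Instantiation of names and substitution for recursion variables -/

namespace FHML

universe u t

namespace Formula

variable {A : Type u} {T : Type t}

theorem _root_.FHML.Term.inst_of_none {γ : ℕ → Option A} {u : Term A}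
    (h : ∀ x, u = .var x → γ x = none) : u.inst γ = u := by
  cases u with
  | name a => rfl
  | var x => simp [Term.inst, h x rfl]

theorem _root_.FHML.Term.inst_eq_var {γ : ℕ → Option A} {u : Term A} {x : ℕ} :
    u.inst γ = .var x ↔ u = .var x ∧ γ x = none := by
  cases u with
  | name a => simp [Term.inst]
  | var y =>
    simp only [Term.inst, Term.var.injEq]
    cases h : γ y with
    | none =>
      simp only [Term.var.injEq]
      exact ⟨fun e => ⟨e, e ▸ h⟩, fun e => e.1⟩
    | some a =>
      simp only [reduceCtorEq, false_iff, not_and]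
      rintro rfl
      simp [h]

theorem extend_none_eq_none {n : ℕ} {xs : Fin n → ℕ} {γ : ℕ → Option A} {x : ℕ} :
    Function.extend xs (fun _ => none) γ x = none ↔ x ∈ Set.range xs ∨ γ x = none := by
  by_cases h : ∃ i, xs i = x
  · simp [Function.extend_def, h]
  · simp [h]

theorem inst_eq_self {φ : Formula A T} {γ : ℕ → Option A} (h : ∀ x ∈ φ.freeNames, γ x = none) :
    φ.inst γ = φ := by
  induction φ generalizing γ with
  | eq u v | ne u v =>
    rw [inst, Term.inst_of_none fun x hx => h x (.inl hx),
      Term.inst_of_none fun x hx => h x (.inr hx)]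
  | rvar X us =>
    rw [inst]
    congr 1
    funext i
    exact Term.inst_of_none fun x hx => h x ⟨i, hx⟩
  | neg φ ih => rw [inst, ih h]
  | or φ₁ φ₂ ih₁ ih₂ | and φ₁ φ₂ ih₁ ih₂ =>
    rw [inst, ih₁ fun x hx => h x (.inl hx), ih₂ fun x hx => h x (.inr hx)]
  | bigOr y φ ih | bigAnd y φ ih | fresh y φ ih | freshAll y φ ih =>
    rw [inst, ih]
    intro x hx
    by_cases hxy : x = y
    · simp [hxy]
    · rw [Function.update_of_ne hxy]
      exact h x ⟨hx, hxy⟩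
  | dia t us φ ih | box t us φ ih =>
    rw [inst, ih fun x hx => h x (.inr hx)]
    congr 1
    refine (List.map_congr_left fun u hu => ?_).trans (List.map_id us)
    exact Term.inst_of_none fun x hx => h x (.inl (show Term.var x ∈ us from hx ▸ hu))
  | fix σ X xs φ us ih =>
    rw [inst, ih]
    · congr 1
      funext i
      exact Term.inst_of_none fun x hx => h x (.inr ⟨i, hx⟩)
    · intro x hx
      rw [extend_none_eq_none]
      exact or_iff_not_imp_left.mpr fun hn => h x (.inl ⟨hx, hn⟩)

theorem freeNames_inst (φ : Formula A T) (γ : ℕ → Option A) :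
    (φ.inst γ).freeNames = {x ∈ φ.freeNames | γ x = none} := by
  induction φ generalizing γ with
  | eq u v | ne u v =>
    ext x
    simp only [inst, freeNames, Term.inst_eq_var, Set.mem_ofPred_eq]
    tauto
  | rvar X us =>
    ext x
    simp [inst, freeNames, Term.inst_eq_var]
  | neg φ ih => exact ih γ
  | or φ₁ φ₂ ih₁ ih₂ | and φ₁ φ₂ ih₁ ih₂ =>
    ext x
    simp only [inst, freeNames, ih₁, ih₂, Set.mem_union, Set.mem_ofPred_eq]
    tauto
  | bigOr y φ ih | bigAnd y φ ih | fresh y φ ih | freshAll y φ ih =>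
    ext x
    simp only [inst, freeNames, ih, Set.mem_sdiff, Set.mem_singleton_iff, Set.mem_ofPred_eq]
    by_cases hxy : x = y
    · simp [hxy]
    · simp [hxy]
  | dia t us φ ih | box t us φ ih =>
    ext x
    have : Term.var x ∈ us.map (Term.inst γ) ↔ Term.var x ∈ us ∧ γ x = none := by
      simp only [List.mem_map, Term.inst_eq_var]
      exact ⟨fun ⟨u, hu, h, hg⟩ => ⟨h ▸ hu, hg⟩, fun ⟨hu, hg⟩ => ⟨_, hu, rfl, hg⟩⟩
    simp only [inst, freeNames, ih, Set.mem_union, Set.mem_ofPred_eq, this]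
    tauto
  | fix σ X xs φ us ih =>
    ext x
    simp only [inst, freeNames, ih, Set.mem_union, Set.mem_sdiff, Set.mem_ofPred_eq,
      Term.inst_eq_var, extend_none_eq_none, exists_and_right]
    tauto

theorem freeNames_inst1 {φ : Formula A T} {x : ℕ} (h : φ.freeNames \ {x} = ∅) (a : A) :
    (φ.inst1 x a).freeNames = ∅ := by
  rw [inst1, freeNames_inst]
  refine Set.eq_empty_of_forall_notMem fun y ⟨hy, hn⟩ => ?_
  by_cases hyx : y = x
  · simp [hyx] at hn
  · exact (h ▸ (⟨hy, hyx⟩ : y ∈ φ.freeNames \ {x}) : y ∈ (∅ : Set ℕ))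

theorem freeNames_instN {φ : Formula A T} {n : ℕ} {xs : Fin n → ℕ}
    (h : φ.freeNames ⊆ Set.range xs) (as : Fin n → A) : (φ.instN xs as).freeNames = ∅ := by
  rw [instN, freeNames_inst]
  refine Set.eq_empty_of_forall_notMem fun y ⟨hy, hn⟩ => ?_
  obtain ⟨i, rfl⟩ := h hy
  simp [Function.extend_def] at hn

@[simp]
theorem freeRVars_inst (φ : Formula A T) (γ : ℕ → Option A) :
    (φ.inst γ).freeRVars = φ.freeRVars := by
  induction φ generalizing γ <;> simp_all [inst, freeRVars]

@[simp]
theorem boundRVars_inst (φ : Formula A T) (γ : ℕ → Option A) :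
    (φ.inst γ).boundRVars = φ.boundRVars := by
  induction φ generalizing γ <;> simp_all [inst, boundRVars]

@[simp]
theorem freeRVars_inst1 (φ : Formula A T) (x : ℕ) (a : A) :
    (φ.inst1 x a).freeRVars = φ.freeRVars :=
  freeRVars_inst _ _

@[simp]
theorem boundRVars_inst1 (φ : Formula A T) (x : ℕ) (a : A) :
    (φ.inst1 x a).boundRVars = φ.boundRVars :=
  boundRVars_inst _ _

@[simp]
theorem freeRVars_instN (φ : Formula A T) {n : ℕ} (xs : Fin n → ℕ) (as : Fin n → A) :
    (φ.instN xs as).freeRVars = φ.freeRVars :=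
  freeRVars_inst _ _

@[simp]
theorem boundRVars_instN (φ : Formula A T) {n : ℕ} (xs : Fin n → ℕ) (as : Fin n → A) :
    (φ.instN xs as).boundRVars = φ.boundRVars :=
  boundRVars_inst _ _

/-- By `hθ`, names enter `θ X us` only through `us`, so it does not matter whether they are
instantiated before or after the replacement. -/
theorem inst_rsubst {θ : ∀ X : RVar, (Fin X.arity → Term A) → Formula A T}
    (hθ : ∀ X us γ, (θ X us).inst γ = θ X (fun i => (us i).inst γ)) (φ : Formula A T)
    (γ : ℕ → Option A) : (φ.rsubst θ).inst γ = (φ.inst γ).rsubst θ := by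
  induction φ generalizing γ θ with
  | fix σ X xs φ us ih =>
    simp only [rsubst, inst]
    rw [ih]
    intro Y vs γ
    by_cases h : Y = X
    · subst h
      simp [inst]
    · simp [h, hθ]
  | _ => simp_all [rsubst, inst]

theorem rsubst_congr {θ θ' : ∀ X : RVar, (Fin X.arity → Term A) → Formula A T} {φ : Formula A T}
    (h : ∀ X ∈ φ.freeRVars, θ X = θ' X) : φ.rsubst θ = φ.rsubst θ' := by
  induction φ generalizing θ θ' with
  | eq | ne => rfl
  | rvar X us => simp [rsubst, h X rfl]
  | or φ₁ φ₂ ih₁ ih₂ | and φ₁ φ₂ ih₁ ih₂ =>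
    rw [rsubst, rsubst, ih₁ fun X hX => h X (.inl hX), ih₂ fun X hX => h X (.inr hX)]
  | fix σ X xs φ us ih =>
    rw [rsubst, rsubst, ih]
    intro Y hY
    by_cases hYX : Y = X
    · subst hYX
      simp
    · simp [hYX, h Y ⟨hY, hYX⟩]
  | neg φ ih | bigOr y φ ih | bigAnd y φ ih | fresh y φ ih | freshAll y φ ih | dia t us φ ih
  | box t us φ ih => rw [rsubst, rsubst, ih h]

@[simp]
theorem rsubst_rvar (φ : Formula A T) : φ.rsubst rvar = φ := by
  induction φ <;> simp_all [rsubst]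

theorem rsubst_eq_self {θ : ∀ X : RVar, (Fin X.arity → Term A) → Formula A T} {φ : Formula A T}
    (h : ∀ X ∈ φ.freeRVars, θ X = rvar X) : φ.rsubst θ = φ :=
  (rsubst_congr h).trans φ.rsubst_rvar

/-- Below an operator that binds `Y`, both substitutions are reset at `Y`, so `θ₂` would miss a free
`Y` inserted by `θ₁`. The condition `hb` makes this harmless: either `θ₂` is trivial at `Y`, or `θ₁`
inserts no free `Y` for another variable. -/
theorem rsubst_rsubst {θ₁ θ₂ θ₃ : ∀ X : RVar, (Fin X.arity → Term A) → Formula A T}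
    {φ : Formula A T} (h : ∀ X us, (θ₁ X us).rsubst θ₂ = θ₃ X us)
    (hb : ∀ Y ∈ φ.boundRVars, θ₂ Y = rvar Y ∨ ∀ X ≠ Y, ∀ us, Y ∉ (θ₁ X us).freeRVars) :
    (φ.rsubst θ₁).rsubst θ₂ = φ.rsubst θ₃ := by
  induction φ generalizing θ₁ θ₂ θ₃ with
  | eq | ne => rfl
  | rvar X us => exact h X us
  | or φ₁ φ₂ ih₁ ih₂ | and φ₁ φ₂ ih₁ ih₂ =>
    simp only [rsubst]
    rw [ih₁ h fun Y hY => hb Y (List.mem_append_left _ hY),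
      ih₂ h fun Y hY => hb Y (List.mem_append_right _ hY)]
  | neg φ ih | bigOr y φ ih | bigAnd y φ ih | fresh y φ ih | freshAll y φ ih | dia t us φ ih
  | box t us φ ih =>
    simp only [rsubst]
    rw [ih h hb]
  | fix σ Y ys φ us ih =>
    simp only [rsubst]
    rw [ih]
    · intro X us
      by_cases hXY : X = Y
      · subst hXY
        simp [rsubst]
      · rw [Function.update_of_ne hXY, Function.update_of_ne hXY, ← h X us]
        refine rsubst_congr fun Z hZ => ?_
        by_cases hZY : Z = Y
        · subst hZY
          rcases hb Z (List.mem_cons_self ..) with h' | h'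
          · simp [h']
          · exact absurd hZ (h' X hXY _)
        · simp [hZY]
    · intro Z hZ
      by_cases hZY : Z = Y
      · exact .inl (by subst hZY; simp)
      · rw [Function.update_of_ne hZY]
        refine (hb Z (List.mem_cons_of_mem _ hZ)).imp_right fun h' X hX us => ?_
        by_cases hXY : X = Y
        · subst hXY
          simpa [freeRVars] using hX.symm
        · rw [Function.update_of_ne hXY]
          exact h' X hX us

theorem freeRVars_rsubst {θ : ∀ X : RVar, (Fin X.arity → Term A) → Formula A T} {φ : Formula A T}
    {Y : RVar} (h : Y ∈ (φ.rsubst θ).freeRVars) :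
    ∃ X ∈ φ.freeRVars, ∃ us, Y ∈ (θ X us).freeRVars := by
  induction φ generalizing θ with
  | eq | ne => exact h.elim
  | rvar X us => exact ⟨X, rfl, us, h⟩
  | or φ₁ φ₂ ih₁ ih₂ | and φ₁ φ₂ ih₁ ih₂ =>
    rcases h with h | h
    · obtain ⟨X, hX, h⟩ := ih₁ h
      exact ⟨X, .inl hX, h⟩
    · obtain ⟨X, hX, h⟩ := ih₂ h
      exact ⟨X, .inr hX, h⟩
  | neg φ ih | bigOr y φ ih | bigAnd y φ ih | fresh y φ ih | freshAll y φ ih | dia t us φ ih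
  | box t us φ ih => exact ih h
  | fix σ Z zs φ us ih =>
    obtain ⟨X, hX, us, h'⟩ := ih h.1
    by_cases hXZ : X = Z
    · subst hXZ
      simp only [Function.update_self, freeRVars, Set.mem_singleton_iff] at h'
      exact absurd h' h.2
    · rw [Function.update_of_ne hXZ] at h'
      exact ⟨X, ⟨hX, hXZ⟩, us, h'⟩

theorem boundRVars_rsubst {θ : ∀ X : RVar, (Fin X.arity → Term A) → Formula A T} {φ : Formula A T}
    {Y : RVar} (h : Y ∈ (φ.rsubst θ).boundRVars) :
    Y ∈ φ.boundRVars ∨ ∃ X us, Y ∈ (θ X us).boundRVars := by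
  induction φ generalizing θ with
  | eq | ne => exact .inl h
  | rvar X us => exact .inr ⟨X, us, h⟩
  | or φ₁ φ₂ ih₁ ih₂ | and φ₁ φ₂ ih₁ ih₂ =>
    rcases List.mem_append.mp h with h | h
    · exact (ih₁ h).imp_left (List.mem_append_left _)
    · exact (ih₂ h).imp_left (List.mem_append_right _)
  | neg φ ih | bigOr y φ ih | bigAnd y φ ih | fresh y φ ih | freshAll y φ ih | dia t us φ ih
  | box t us φ ih => exact ih h
  | fix σ Z zs φ us ih =>
    rcases List.mem_cons.mp h with rfl | h
    · exact .inl (List.mem_cons_self ..)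
    · rcases ih h with h | ⟨X, us, h⟩
      · exact .inl (List.mem_cons_of_mem _ h)
      · by_cases hXZ : X = Z
        · subst hXZ
          simp [boundRVars] at h
        · rw [Function.update_of_ne hXZ] at h
          exact .inr ⟨X, us, h⟩

/-! ### Substituting a fixpoint formula for its variable -/

/-- The substitution of `σX(xs).φ` for the recursion variable `X`. -/
def fixSubst (σ : FixKind) (X : RVar) (xs : Fin X.arity → ℕ) (φ : Formula A T) :
    ∀ Y : RVar, (Fin Y.arity → Term A) → Formula A T :=
  Function.update rvar X (fix σ X xs φ)

section fixSubst

variable {σ : FixKind} {X : RVar} {xs : Fin X.arity → ℕ} {φ : Formula A T}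

@[simp]
theorem fixSubst_self : fixSubst σ X xs φ X = fix σ X xs φ :=
  Function.update_self ..

theorem fixSubst_of_ne {Y : RVar} (h : Y ≠ X) : fixSubst σ X xs φ Y = rvar Y :=
  Function.update_of_ne h ..

theorem update_fixSubst {Y : RVar} (h : Y ≠ X) :
    Function.update (fixSubst σ X xs φ) Y (rvar Y) = fixSubst σ X xs φ :=
  Function.update_eq_self_iff.mpr (fixSubst_of_ne h).symm

theorem fixSubst_inst (h : φ.freeNames ⊆ Set.range xs) (Y : RVar) (us : Fin Y.arity → Term A)
    (γ : ℕ → Option A) :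
    (fixSubst σ X xs φ Y us).inst γ = fixSubst σ X xs φ Y (fun i => (us i).inst γ) := by
  by_cases hY : Y = X
  · subst hY
    simp only [fixSubst_self, inst]
    rw [inst_eq_self fun x hx => extend_none_eq_none.mpr (.inl (h hx))]
  · simp [fixSubst_of_ne hY, inst]

theorem inst1_rsubst_fixSubst (h : φ.freeNames ⊆ Set.range xs) (χ : Formula A T) (x : ℕ) (a : A) :
    (χ.rsubst (fixSubst σ X xs φ)).inst1 x a = (χ.inst1 x a).rsubst (fixSubst σ X xs φ) :=
  inst_rsubst (fixSubst_inst h) _ _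

theorem instN_rsubst_fixSubst (h : φ.freeNames ⊆ Set.range xs) (χ : Formula A T) {n : ℕ}
    (ys : Fin n → ℕ) (as : Fin n → A) :
    (χ.rsubst (fixSubst σ X xs φ)).instN ys as = (χ.instN ys as).rsubst (fixSubst σ X xs φ) :=
  inst_rsubst (fixSubst_inst h) _ _

theorem unfold_eq (h : φ.freeNames ⊆ Set.range xs) (as : Fin X.arity → A) :
    unfold σ X xs φ as = (φ.instN xs as).rsubst (fixSubst σ X xs φ) :=
  instN_rsubst_fixSubst h φ xs as

theorem freeRVars_fixSubst {Y Z : RVar} {us : Fin Y.arity → Term A}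
    (h : Z ∈ (fixSubst σ X xs φ Y us).freeRVars) :
    Y = X ∧ Z ∈ φ.freeRVars ∧ Z ≠ X ∨ Y ≠ X ∧ Z = Y := by
  by_cases hY : Y = X
  · subst hY
    rw [fixSubst_self] at h
    exact .inl ⟨rfl, h⟩
  · rw [fixSubst_of_ne hY] at h
    exact .inr ⟨hY, h⟩

/-- Both sides amount to one simultaneous substitution for `X` and `Y`. Since `Y` is not free in
`φ`, the copies of `σX(xs).φ` inserted first are not touched by the substitution for `Y`. -/
theorem rsubst_fixSubst_comm {τ : FixKind} {Y : RVar} {ys : Fin Y.arity → ℕ} {χ : Formula A T}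
    (hYX : Y ≠ X) (hYφ : Y ∉ φ.freeRVars) (hχ : ∀ Z ∈ χ.boundRVars, Z ≠ X ∧ Z ∉ φ.freeRVars) :
    (χ.rsubst (fixSubst σ X xs φ)).rsubst
        (fixSubst τ Y ys (χ.rsubst (fixSubst σ X xs φ))) =
      (χ.rsubst (fixSubst τ Y ys χ)).rsubst (fixSubst σ X xs φ) := by
  rw [rsubst_rsubst (fun _ _ => rfl), rsubst_rsubst (fun _ _ => rfl)]
  · refine rsubst_congr fun Z _ => ?_
    funext us
    by_cases hZX : Z = X
    · subst hZX
      rw [fixSubst_of_ne hYX.symm, fixSubst_self, rsubst_eq_self]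
      · simp [rsubst]
      · rintro W ⟨hW, -⟩
        exact fixSubst_of_ne (by rintro rfl; exact hYφ hW)
    · rw [fixSubst_of_ne hZX]
      by_cases hZY : Z = Y
      · subst hZY
        simp [rsubst, update_fixSubst hYX]
      · simp [fixSubst_of_ne hZY, rsubst, fixSubst_of_ne hZX]
  · exact fun Z hZ => .inl (fixSubst_of_ne (hχ Z hZ).1)
  · refine fun Z hZ => .inr fun W hW us h => ?_
    rcases freeRVars_fixSubst h with ⟨-, h, -⟩ | ⟨-, h⟩
    · exact (hχ Z hZ).2 h
    · exact hW h.symm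

theorem unfold_rsubst_fixSubst (h : φ.freeNames ⊆ Set.range xs) {τ : FixKind} {Y : RVar}
    {ys : Fin Y.arity → ℕ} {χ : Formula A T} (hYX : Y ≠ X) (hYφ : Y ∉ φ.freeRVars)
    (hχ : ∀ Z ∈ χ.boundRVars, Z ≠ X ∧ Z ∉ φ.freeRVars) (as : Fin Y.arity → A) :
    unfold τ Y ys (χ.rsubst (fixSubst σ X xs φ)) as =
      (unfold τ Y ys χ as).rsubst (fixSubst σ X xs φ) := by
  rw [unfold, unfold, ← instN_rsubst_fixSubst h]
  exact congrArg (instN · ys as) (rsubst_fixSubst_comm hYX hYφ hχ)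

end fixSubst

/-- Replacement of each fixpoint operator that binds `X` by the recursion variable `X`. -/
def fold (X : RVar) : Formula A T → Formula A T
  | eq u v => eq u v
  | ne u v => ne u v
  | rvar Y us => rvar Y us
  | neg φ => neg (φ.fold X)
  | or φ₁ φ₂ => or (φ₁.fold X) (φ₂.fold X)
  | and φ₁ φ₂ => and (φ₁.fold X) (φ₂.fold X)
  | bigOr x φ => bigOr x (φ.fold X)
  | bigAnd x φ => bigAnd x (φ.fold X)
  | fresh x φ => fresh x (φ.fold X)
  | freshAll x φ => freshAll x (φ.fold X)
  | dia t us φ => dia t us (φ.fold X)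
  | box t us φ => box t us (φ.fold X)
  | fix σ Y ys φ us => if Y = X then rvar Y us else fix σ Y ys (φ.fold X) us

/-- `fold` inverts the substitution when `X` is not bound in `χ`. Hence distinct positions of the
body game have distinct images. -/
theorem fold_rsubst_fixSubst {σ : FixKind} {X : RVar} {xs : Fin X.arity → ℕ} {φ χ : Formula A T}
    (h : X ∉ χ.boundRVars) : (χ.rsubst (fixSubst σ X xs φ)).fold X = χ := by
  induction χ with
  | rvar Y us =>
    by_cases hY : Y = X
    · subst hY
      simp [rsubst, fold]
    · simp [rsubst, fixSubst_of_ne hY, fold]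
  | fix τ Y ys χ us ih =>
    simp only [boundRVars, List.mem_cons, not_or] at h
    rw [rsubst, fold, if_neg (Ne.symm h.1), update_fixSubst (Ne.symm h.1), ih h.2]
  | _ => simp_all [rsubst, fold, boundRVars]

/-! ### A ranking condition preserved by unfolding -/

/-- A rank has the parity that belongs to the kind of a fixpoint. -/
def _root_.FHML.FixKind.HasParity : FixKind → ℕ → Prop
  | .mu, n => Odd n
  | .nu, n => Even n

/-- The formula is negation-free, its fixpoint operators bind variables in `B`, and `Ω` ranks them
as in a ranking. -/
def Ranked (B : Set RVar) (Ω : RVar → ℕ) : Formula A T → Prop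
  | eq _ _ | ne _ _ | rvar _ _ => True
  | neg _ => False
  | or φ₁ φ₂ | and φ₁ φ₂ => φ₁.Ranked B Ω ∧ φ₂.Ranked B Ω
  | bigOr _ φ | bigAnd _ φ | fresh _ φ | freshAll _ φ | dia _ _ φ | box _ _ φ => φ.Ranked B Ω
  | fix σ X _ φ _ => X ∈ B ∧ σ.HasParity (Ω X) ∧ (∀ Y ∈ B, Y ∈ φ.freeRVars → Ω X ≤ Ω Y) ∧
      φ.Ranked B Ω

variable {B : Set RVar} {Ω : RVar → ℕ}

theorem mem_subformulas_self (φ : Formula A T) : φ ∈ φ.subformulas := by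
  cases φ <;> simp [subformulas]

theorem ranked_of_subformulas {φ : Formula A T} (hneg : ∀ χ, neg χ ∉ φ.subformulas)
    (h : ∀ σ X xs χ us, fix σ X xs χ us ∈ φ.subformulas → X ∈ B ∧ σ.HasParity (Ω X) ∧
      ∀ Y ∈ B, Y ∈ (fix σ X xs χ us).freeRVars → Ω X ≤ Ω Y) : φ.Ranked B Ω := by
  induction φ with
  | eq | ne | rvar => trivial
  | neg φ ih => exact hneg φ (mem_subformulas_self _)
  | or φ₁ φ₂ ih₁ ih₂ | and φ₁ φ₂ ih₁ ih₂ =>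
    exact ⟨ih₁ (fun χ hχ => hneg χ (.inr (.inl hχ)))
        fun σ X xs χ us hχ => h σ X xs χ us (.inr (.inl hχ)),
      ih₂ (fun χ hχ => hneg χ (.inr (.inr hχ)))
        fun σ X xs χ us hχ => h σ X xs χ us (.inr (.inr hχ))⟩
  | bigOr y φ ih | bigAnd y φ ih | fresh y φ ih | freshAll y φ ih | dia t us φ ih
  | box t us φ ih =>
    exact ih (fun χ hχ => hneg χ (.inr hχ)) fun σ X xs χ us hχ => h σ X xs χ us (.inr hχ)
  | fix σ X xs φ us ih =>
    obtain ⟨h1, h2, h3⟩ := h σ X xs φ us (mem_subformulas_self _)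
    refine ⟨h1, h2, fun Y hY hf => ?_,
      ih (fun χ hχ => hneg χ (.inr hχ)) fun σ X xs χ us hχ => h σ X xs χ us (.inr hχ)⟩
    by_cases hYX : Y = X
    · rw [hYX]
    · exact h3 Y hY ⟨hf, hYX⟩

@[simp]
theorem ranked_inst {φ : Formula A T} {γ : ℕ → Option A} :
    (φ.inst γ).Ranked B Ω ↔ φ.Ranked B Ω := by
  induction φ generalizing γ <;> simp_all [inst, Ranked]

@[simp]
theorem ranked_inst1 {φ : Formula A T} {x : ℕ} {a : A} :
    (φ.inst1 x a).Ranked B Ω ↔ φ.Ranked B Ω :=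
  ranked_inst

@[simp]
theorem ranked_instN {φ : Formula A T} {n : ℕ} {xs : Fin n → ℕ} {as : Fin n → A} :
    (φ.instN xs as).Ranked B Ω ↔ φ.Ranked B Ω :=
  ranked_inst

/-- Unfolding may bind a variable twice, but it keeps `Ranked`. By `hle`, a variable of `B` brought
in for `X` ranks at least as high as `X`, so the inequality at each enclosing fixpoint operator
persists by transitivity. -/
theorem Ranked.rsubst {θ : ∀ X : RVar, (Fin X.arity → Term A) → Formula A T} {φ : Formula A T}
    (h : φ.Ranked B Ω) (hθ : ∀ X us, (θ X us).Ranked B Ω)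
    (hle : ∀ X us, ∀ Y ∈ B, Y ∈ (θ X us).freeRVars → X ∈ B ∧ Ω X ≤ Ω Y) :
    (φ.rsubst θ).Ranked B Ω := by
  induction φ generalizing θ with
  | eq | ne => trivial
  | neg => exact h.elim
  | rvar X us => exact hθ X us
  | or φ₁ φ₂ ih₁ ih₂ | and φ₁ φ₂ ih₁ ih₂ => exact ⟨ih₁ h.1 hθ hle, ih₂ h.2 hθ hle⟩
  | bigOr y φ ih | bigAnd y φ ih | fresh y φ ih | freshAll y φ ih | dia t us φ ih
  | box t us φ ih => exact ih h hθ hle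
  | fix σ Z zs φ us ih =>
    have hle' : ∀ X us, ∀ Y ∈ B, Y ∈ (Function.update θ Z (rvar Z) X us).freeRVars →
        X ∈ B ∧ Ω X ≤ Ω Y := by
      intro X us Y hY hf
      by_cases hX : X = Z
      · subst hX
        simp only [Function.update_self, freeRVars, Set.mem_singleton_iff] at hf
        subst hf
        exact ⟨hY, le_rfl⟩
      · rw [Function.update_of_ne hX] at hf
        exact hle X us Y hY hf
    refine ⟨h.1, h.2.1, fun Y hY hf => ?_, ih h.2.2.2 (fun X us => ?_) hle'⟩
    · obtain ⟨X, hX, us, hf⟩ := freeRVars_rsubst hf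
      obtain ⟨h1, h2⟩ := hle' X us Y hY hf
      exact (h.2.2.1 X h1 hX).trans h2
    · by_cases hX : X = Z
      · subst hX
        simp [Ranked]
      · rw [Function.update_of_ne hX]
        exact hθ X us

section unfold

variable {σ : FixKind} {X : RVar} {xs : Fin X.arity → ℕ} {φ : Formula A T}
  {us : Fin X.arity → Term A}

theorem Ranked.unfold (h : (fix σ X xs φ us).Ranked B Ω) (as : Fin X.arity → A) :
    (unfold σ X xs φ as).Ranked B Ω := by
  refine ranked_instN.mpr (h.2.2.2.rsubst (θ := fixSubst σ X xs φ) (fun Y us => ?_)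
    fun Y us Z hZ hf => ?_)
  · by_cases hY : Y = X
    · subst hY
      rw [fixSubst_self]
      exact h
    · rw [fixSubst_of_ne hY]
      trivial
  · rcases freeRVars_fixSubst hf with ⟨rfl, hf, -⟩ | ⟨-, rfl⟩
    · exact ⟨h.1, h.2.2.1 Z hZ hf⟩
    · exact ⟨hZ, le_rfl⟩

theorem freeRVars_unfold_subset (as : Fin X.arity → A) :
    (unfold σ X xs φ as).freeRVars ⊆ (fix σ X xs φ us).freeRVars := by
  intro Y hY
  rw [Formula.unfold, freeRVars_instN] at hY
  obtain ⟨Z, hZ, vs, hY⟩ := freeRVars_rsubst (θ := fixSubst σ X xs φ) hY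
  rcases freeRVars_fixSubst hY with ⟨-, hY⟩ | ⟨h, rfl⟩
  · exact hY
  · exact ⟨hZ, h⟩

theorem boundRVars_unfold_subset (as : Fin X.arity → A) :
    (unfold σ X xs φ as).boundRVars ⊆ (fix σ X xs φ us).boundRVars := by
  intro Y hY
  rw [Formula.unfold, boundRVars_instN] at hY
  rcases boundRVars_rsubst (θ := fixSubst σ X xs φ) hY with h | ⟨Z, vs, h⟩
  · exact List.mem_cons_of_mem _ h
  · by_cases hZ : Z = X
    · subst hZ
      rwa [fixSubst_self] at h
    · rw [fixSubst_of_ne hZ] at h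
      simp [boundRVars] at h

end unfold

end Formula

end FHML

/-! ### Moves in the game of a formula -/

namespace FHML

universe u v w t

section Game

variable {A : Type u} {S : Type v} {L : Type w} {T : Type t} [DecidableEq A]
    [NominalSet A S] [NominalSet A L] {𝓛 : FLTS A S L} {act : ActionTerms A T L}

section GameMove

variable {c : Conf A S} {ξ : Valuation A S} {p : Position A S T}

@[simp]
theorem not_gameMove_eq {u v : Term A} : ¬ 𝓛.GameMove act ⟨c, ξ, .eq u v⟩ p := by
  rintro ⟨⟩

@[simp]
theorem not_gameMove_ne {u v : Term A} : ¬ 𝓛.GameMove act ⟨c, ξ, .ne u v⟩ p := by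
  rintro ⟨⟩

@[simp]
theorem not_gameMove_rvar {X : RVar} {us : Fin X.arity → Term A} :
    ¬ 𝓛.GameMove act ⟨c, ξ, .rvar X us⟩ p := by
  rintro ⟨⟩

@[simp]
theorem not_gameMove_neg {φ : Formula A T} : ¬ 𝓛.GameMove act ⟨c, ξ, .neg φ⟩ p := by
  rintro ⟨⟩

@[simp]
theorem gameMove_or {φ₁ φ₂ : Formula A T} :
    𝓛.GameMove act ⟨c, ξ, .or φ₁ φ₂⟩ p ↔ ⟨c, ξ, φ₁⟩ = p ∨ ⟨c, ξ, φ₂⟩ = p := by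
  constructor
  · rintro ⟨⟩ <;> simp
  · rintro (rfl | rfl) <;> constructor

@[simp]
theorem gameMove_and {φ₁ φ₂ : Formula A T} :
    𝓛.GameMove act ⟨c, ξ, .and φ₁ φ₂⟩ p ↔ ⟨c, ξ, φ₁⟩ = p ∨ ⟨c, ξ, φ₂⟩ = p := by
  constructor
  · rintro ⟨⟩ <;> simp
  · rintro (rfl | rfl) <;> constructor

@[simp]
theorem gameMove_bigOr {x : ℕ} {φ : Formula A T} :
    𝓛.GameMove act ⟨c, ξ, .bigOr x φ⟩ p ↔ ∃ a, ⟨c, ξ, φ.inst1 x a⟩ = p := by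
  constructor
  · rintro ⟨⟩; exact ⟨_, rfl⟩
  · rintro ⟨a, rfl⟩; constructor

@[simp]
theorem gameMove_bigAnd {x : ℕ} {φ : Formula A T} :
    𝓛.GameMove act ⟨c, ξ, .bigAnd x φ⟩ p ↔ ∃ a, ⟨c, ξ, φ.inst1 x a⟩ = p := by
  constructor
  · rintro ⟨⟩; exact ⟨_, rfl⟩
  · rintro ⟨a, rfl⟩; constructor

@[simp]
theorem gameMove_fresh {x : ℕ} {φ : Formula A T} :
    𝓛.GameMove act ⟨c, ξ, .fresh x φ⟩ p ↔ ∃ a, a ∉ c.hist ∧ ⟨c, ξ, φ.inst1 x a⟩ = p := by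
  constructor
  · rintro ⟨⟩; exact ⟨_, ‹_›, rfl⟩
  · rintro ⟨a, ha, rfl⟩; exact .fresh _ _ _ _ _ ha

@[simp]
theorem gameMove_freshAll {x : ℕ} {φ : Formula A T} :
    𝓛.GameMove act ⟨c, ξ, .freshAll x φ⟩ p ↔ ∃ a, a ∉ c.hist ∧ ⟨c, ξ, φ.inst1 x a⟩ = p := by
  constructor
  · rintro ⟨⟩; exact ⟨_, ‹_›, rfl⟩
  · rintro ⟨a, ha, rfl⟩; exact .freshAll _ _ _ _ _ ha

@[simp]
theorem gameMove_dia {t : T} {us : List (Term A)} {φ : Formula A T} :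
    𝓛.GameMove act ⟨c, ξ, .dia t us φ⟩ p ↔ ∃ c', 𝓛.Step act t us c c' ∧ ⟨c', ξ, φ⟩ = p := by
  constructor
  · rintro ⟨⟩; exact ⟨_, ‹_›, rfl⟩
  · rintro ⟨c', h, rfl⟩; exact .dia _ _ _ _ _ _ h

@[simp]
theorem gameMove_box {t : T} {us : List (Term A)} {φ : Formula A T} :
    𝓛.GameMove act ⟨c, ξ, .box t us φ⟩ p ↔ ∃ c', 𝓛.Step act t us c c' ∧ ⟨c', ξ, φ⟩ = p := by
  constructor
  · rintro ⟨⟩; exact ⟨_, ‹_›, rfl⟩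
  · rintro ⟨c', h, rfl⟩; exact .box _ _ _ _ _ _ h

@[simp]
theorem gameMove_fix {σ : FixKind} {X : RVar} {xs : Fin X.arity → ℕ} {φ : Formula A T}
    {us : Fin X.arity → Term A} :
    𝓛.GameMove act ⟨c, ξ, .fix σ X xs φ us⟩ p ↔
      ∃ as, us = Term.name ∘ as ∧ ⟨c, ξ, φ.unfold σ X xs as⟩ = p := by
  constructor
  · rintro ⟨⟩; exact ⟨_, rfl, rfl⟩
  · rintro ⟨as, rfl, rfl⟩; constructor

end GameMove

theorem FLTS.GameMove.val_eq {p q : Position A S T} (h : 𝓛.GameMove act p q) : q.val = p.val := by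
  cases h <;> rfl

theorem FLTS.GameMove.freeRVars_subset {p q : Position A S T} (h : 𝓛.GameMove act p q) :
    q.form.freeRVars ⊆ p.form.freeRVars := by
  cases h with
  | fix => exact Formula.freeRVars_unfold_subset _
  | _ => simp [Formula.freeRVars]

theorem FLTS.GameMove.boundRVars_subset {p q : Position A S T} (h : 𝓛.GameMove act p q) :
    q.form.boundRVars ⊆ p.form.boundRVars := by
  cases h with
  | fix => exact Formula.boundRVars_unfold_subset _
  | _ => simp [Formula.boundRVars]

theorem FLTS.GameMove.ranked {B : Set RVar} {Ω : RVar → ℕ} {p q : Position A S T}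
    (h : 𝓛.GameMove act p q) (hp : p.form.Ranked B Ω) : q.form.Ranked B Ω := by
  cases h with
  | fix => exact hp.unfold _
  | _ => simp_all [Formula.Ranked]

theorem owner_rvar_eq_attacker {c : Conf A S} {ξ : Valuation A S} {X : RVar}
    {us : Fin X.arity → Term A} :
    Position.owner (⟨c, ξ, .rvar X us⟩ : Position A S T) = .attacker ↔
      ∃ as, us = Term.name ∘ as ∧ c ∈ ξ X as := by
  unfold Position.owner
  dsimp only
  split_ifs with h <;> simpa using h

/-- Moves commute with the substitution because `hx` and `hb` exclude capture, of names and of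
recursion variables. The atom `X(us)` is the one exception: it has no moves, but its image is a
fixpoint formula, which may be unfolded. Valuations do not affect moves. -/
theorem gameMove_rsubst_iff {σ : FixKind} {X : RVar} {xs : Fin X.arity → ℕ} {φ χ : Formula A T}
    (hx : φ.freeNames ⊆ Set.range xs) (hb : ∀ Z ∈ χ.boundRVars, Z ≠ X ∧ Z ∉ φ.freeRVars)
    (hχ : ∀ us, χ ≠ .rvar X us) {c : Conf A S} {ξ ξ' : Valuation A S} (p : Position A S T) :
    𝓛.GameMove act ⟨c, ξ, χ.rsubst (.fixSubst σ X xs φ)⟩ p ↔ ∃ q : Position A S T,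
      𝓛.GameMove act ⟨c, ξ', χ⟩ q ∧ ⟨q.conf, ξ, q.form.rsubst (.fixSubst σ X xs φ)⟩ = p := by
  cases χ with
  | rvar Y us =>
    have hY : Y ≠ X := by
      rintro rfl
      exact hχ us rfl
    simp [Formula.rsubst, Formula.fixSubst_of_ne hY]
  | fix τ Y ys χ us =>
    simp only [Formula.boundRVars, List.mem_cons, forall_eq_or_imp] at hb
    obtain ⟨⟨hYX, hYφ⟩, hb⟩ := hb
    simp only [Formula.rsubst, Formula.update_fixSubst hYX, gameMove_fix,
      Formula.unfold_rsubst_fixSubst hx hYX hYφ hb]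
    constructor
    · rintro ⟨as, h, rfl⟩
      exact ⟨_, ⟨as, h, rfl⟩, rfl⟩
    · rintro ⟨_, ⟨as, h, rfl⟩, rfl⟩
      exact ⟨as, h, rfl⟩
  | _ =>
    simp [Formula.rsubst, Formula.inst1_rsubst_fixSubst hx, or_and_right, exists_or]

/-! ### The game of a fixpoint formula as an unfolding of the game of its body -/

/-- The game of a fixpoint formula `σX(xs).φ`, as an unfolding of the game in which the recursion
variable `X` is free and has the value `f`. -/
noncomputable def fixUnfolding (𝓛 : FLTS A S L) (act : ActionTerms A T L) {B : Set RVar}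
    {Ω : RVar → ℕ} {σ : FixKind} {X : RVar} {xs : Fin X.arity → ℕ} {φ : Formula A T}
    (hX : X ∈ B) (hr : φ.Ranked B Ω) (hx : φ.freeNames ⊆ Set.range xs)
    (hb : ∀ Z ∈ φ.boundRVars, Z ≠ X ∧ Z ∉ φ.freeRVars) (ξ : Valuation A S)
    (f : (Fin X.arity → A) → Set (Conf A S)) : (𝓛.game act Ω).Unfolding where
  -- The condition on bound variables excludes capture and, unlike distinctness of bound variables,
  -- passes to all later positions.
  dom := {q : Position A S T | q.val = Function.update ξ X f ∧ q.form.Ranked B Ω ∧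
    ∀ Z ∈ q.form.boundRVars, Z ≠ X ∧ Z ∉ φ.freeRVars}
  sink := {q : Position A S T | ∃ us, q.form = .rvar X us}
  live := {q : Position A S T | X ∈ q.form.freeRVars}
  map := fun q : Position A S T => ⟨q.conf, ξ, q.form.rsubst (.fixSubst σ X xs φ)⟩
  d := Ω X
  injOn := by
    rintro ⟨c, ξ₁, χ⟩ ⟨rfl, -, h⟩ ⟨c', ξ₂, χ'⟩ ⟨rfl, -, h'⟩ he
    obtain rfl : c = c' := congrArg Position.conf he
    have h₁ : (χ.rsubst (.fixSubst σ X xs φ)).fold X = (χ'.rsubst (.fixSubst σ X xs φ)).fold X :=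
      congrArg (fun q : Position A S T => q.form.fold X) he
    rw [Formula.fold_rsubst_fixSubst fun hX => (h X hX).1 rfl,
      Formula.fold_rsubst_fixSubst fun hX => (h' X hX).1 rfl] at h₁
    exact congrArg (Position.mk c (Function.update ξ X f)) h₁
  move_mem := fun q hq q' (h : 𝓛.GameMove act q q') =>
    ⟨h.val_eq.trans hq.1, h.ranked hq.2.1, fun Z hZ => hq.2.2 Z (h.boundRVars_subset hZ)⟩
  not_move_of_sink := by
    rintro ⟨c, ξ', χ⟩ ⟨us, rfl : χ = _⟩ q'
    exact not_gameMove_rvar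
  owner_map := by
    rintro ⟨c, _, χ⟩ ⟨rfl, h2, h3⟩ hs
    change Position.owner (⟨c, ξ, χ.rsubst (.fixSubst σ X xs φ)⟩ : Position A S T) =
      Position.owner (⟨c, Function.update ξ X f, χ⟩ : Position A S T)
    cases χ with
    | rvar Y us =>
      have hY : Y ≠ X := by
        rintro rfl
        exact hs ⟨us, rfl⟩
      have hp : ∀ i j : Player, (i = .attacker ↔ j = .attacker) → i = j := by
        rintro ⟨⟩ ⟨⟩ <;> simp
      refine hp _ _ ?_
      rw [Formula.rsubst, Formula.fixSubst_of_ne hY, owner_rvar_eq_attacker,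
        owner_rvar_eq_attacker, Function.update_of_ne hY]
    | _ => rfl
  rank_map := by
    rintro ⟨c, _, χ⟩ ⟨rfl, h2, h3⟩ hs
    cases χ with
    | rvar Y us =>
      have hY : Y ≠ X := by
        rintro rfl
        exact hs ⟨us, rfl⟩
      simp [FLTS.game, Formula.rsubst, Formula.fixSubst_of_ne hY, Position.rank]
    | _ => rfl
  move_map := by
    rintro ⟨c, _, χ⟩ ⟨rfl, h2, h3⟩ hs p
    exact gameMove_rsubst_iff hx h3 (fun us h => hs ⟨us, h⟩) p
  owner_map_of_sink := by
    rintro ⟨c, ξ', χ⟩ ⟨us, rfl : χ = _⟩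
    simp [FLTS.game, Formula.rsubst, Position.owner]
  move_map_of_sink := by
    rintro ⟨c, _, χ⟩ ⟨rfl, -, -⟩ ⟨us, rfl : χ = _⟩ p h
    change 𝓛.GameMove act
      ⟨c, ξ, (Formula.rvar X us).rsubst (.fixSubst σ X xs φ)⟩ p at h
    rw [Formula.rsubst, Formula.fixSubst_self] at h
    obtain ⟨as, rfl, rfl⟩ := gameMove_fix.mp h
    -- The unfolding reached from the image of a sink is the image of an instance of the body; here
    -- the play re-enters the copy.
    rw [Formula.unfold_eq hx]
    exact ⟨(⟨c, Function.update ξ X f, φ.instN xs as⟩ : Position A S T),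
      ⟨rfl, by simpa using hr, by simpa using hb⟩, rfl⟩
  rank_map_of_sink := by
    rintro ⟨c, ξ', χ⟩ ⟨us, rfl : χ = _⟩
    simp [FLTS.game, Formula.rsubst, Position.rank]
  sink_subset_live := by
    rintro ⟨c, ξ', χ⟩ ⟨us, rfl : χ = _⟩
    exact Set.mem_singleton X
  live_of_move := fun q _ q' (h : 𝓛.GameMove act q q') hX => h.freeRVars_subset hX
  rank_map_le := by
    rintro ⟨c, ξ', χ⟩ ⟨-, h2, -⟩ hl
    cases χ with
    | rvar Y us =>
      obtain rfl : X = Y := hl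
      simp [FLTS.game, Formula.rsubst, Position.rank]
    -- At a live position `X` is free in the subformula that binds `Y`, so the dependency condition
    -- on rankings gives `Ω Y ≤ Ω X`.
    | fix τ Y ys χ us => exact h2.2.2.1 X hX hl.1
    | _ => exact Nat.zero_le _

/-! ### Denotations and winning regions -/

variable (𝓛 act)

/-- Defender wins from the position `p` of the game of an fHML formula. -/
def FLTS.Wins (Ω : RVar → ℕ) (p : Position A S T) : Prop :=
  (𝓛.game act Ω).DefenderWins p

variable {𝓛 act}

theorem wins_iff_of_defender {Ω : RVar → ℕ} {p : Position A S T} (hp : p.owner = .defender) :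
    𝓛.Wins act Ω p ↔ ∃ q : Position A S T, 𝓛.GameMove act p q ∧ 𝓛.Wins act Ω q :=
  ParityGame.defenderWins_iff_of_defender hp

theorem wins_iff_of_attacker {Ω : RVar → ℕ} {p : Position A S T} (hp : p.owner = .attacker) :
    𝓛.Wins act Ω p ↔ ∀ q : Position A S T, 𝓛.GameMove act p q → 𝓛.Wins act Ω q :=
  ParityGame.defenderWins_iff_of_attacker hp

variable (𝓛 act)

/-- The hypothesis `ih` ranges over all valuations because `X` has to be interpreted by arbitrary
prefixpoints and postfixpoints. If `us` are not all names, both sides are false: the denotation is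
empty and Defender is stuck. -/
theorem mem_sem_fix_iff {B : Set RVar} {Ω : RVar → ℕ} {σ : FixKind} {X : RVar}
    {xs : Fin X.arity → ℕ} {φ : Formula A T} {us : Fin X.arity → Term A}
    (hX : X ∈ B) (hp : σ.HasParity (Ω X)) (hr : φ.Ranked B Ω) (hx : φ.freeNames ⊆ Set.range xs)
    (hb : ∀ Z ∈ φ.boundRVars, Z ≠ X ∧ Z ∉ φ.freeRVars)
    (ih : ∀ (as : Fin X.arity → A) (ξ : Valuation A S) (c : Conf A S),
      c ∈ 𝓛.sem act (φ.instN xs as) ξ ↔ (𝓛.game act Ω).DefenderWins ⟨c, ξ, φ.instN xs as⟩)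
    (ξ : Valuation A S) (c : Conf A S) :
    c ∈ 𝓛.sem act (.fix σ X xs φ us) ξ ↔
      (𝓛.game act Ω).DefenderWins ⟨c, ξ, .fix σ X xs φ us⟩ := by
  set G := 𝓛.game act Ω with hG
  let E := fun f => fixUnfolding 𝓛 act (σ := σ) hX hr hx hb ξ f
  let g : (Fin X.arity → A) → Set (Conf A S) :=
    fun as => {c | G.DefenderWins (⟨c, ξ, .fix σ X xs φ (Term.name ∘ as)⟩ : Position A S T)}
  let body : ((Fin X.arity → A) → Set (Conf A S)) → (Fin X.arity → A) → Conf A S → G.Pos :=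
    fun f as c => (⟨c, Function.update ξ X f, φ.instN xs as⟩ : Position A S T)
  let var : ((Fin X.arity → A) → Set (Conf A S)) → (Fin X.arity → Term A) → Conf A S → G.Pos :=
    fun f us c => (⟨c, Function.update ξ X f, .rvar X us⟩ : Position A S T)
  have body_mem : ∀ f as c, body f as c ∈ (E f).dom := fun f as c =>
    ⟨rfl, Formula.ranked_instN.mpr hr, by simpa [body] using hb⟩
  have map_var : ∀ f us c, (E f).map (var f us c) = (⟨c, ξ, .fix σ X xs φ us⟩ : Position A S T) :=
    fun f us c => congrArg (Position.mk c ξ)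
      (show (Formula.rvar X us).rsubst (.fixSubst σ X xs φ) = _ by
        rw [Formula.rsubst, Formula.fixSubst_self])
  have move_var : ∀ f as c p, G.Move ((E f).map (var f (Term.name ∘ as) c)) p ↔
      (E f).map (body f as c) = p := by
    intro f as c p
    rw [map_var]
    refine gameMove_fix.trans ?_
    simp only [Formula.unfold_eq hx]
    constructor
    · rintro ⟨bs, h, rfl⟩
      obtain rfl : as = bs := funext fun i => Term.name.inj (congrFun h i)
      rfl
    · rintro rfl
      exact ⟨as, rfl, rfl⟩
  have owner_map_var : ∀ f us c, G.owner ((E f).map (var f us c)) = .defender := fun f us c => by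
    rw [map_var]
    rfl
  have owner_var : ∀ f us c, G.owner (var f us c) = .attacker ↔
      ∃ as, us = Term.name ∘ as ∧ c ∈ f as := by
    intro f us c
    refine owner_rvar_eq_attacker.trans ?_
    rw [Function.update_self]
  have wins_var : ∀ f us c, G.DefenderWins (var f us c) ↔ ∃ as, us = Term.name ∘ as ∧ c ∈ f as :=
    fun f us c => (ParityGame.defenderWins_iff_of_no_move fun _ => not_gameMove_rvar).trans
      (owner_var f us c)
  have sink_eq : ∀ f, ∀ q ∈ (E f).dom, q ∈ (E f).sink → ∃ us c, q = var f us c := by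
    rintro f ⟨c, _, χ⟩ ⟨rfl, -⟩ ⟨us, rfl : χ = _⟩
    exact ⟨us, c, rfl⟩
  -- The images no longer depend on `f`, so `g` can be read off from every embedding `E f`: the only
  -- move from the fixpoint formula leads to the image of the body.
  have mem_g : ∀ f as c, c ∈ g as ↔ G.DefenderWins ((E f).map (body f as c)) := by
    intro f as c
    have := ParityGame.defenderWins_iff_of_defender (owner_map_var f (Term.name ∘ as) c)
    simp only [move_var, exists_eq_left'] at this
    rw [← this, map_var]
    rfl
  have wins_map_var : ∀ f us c, G.DefenderWins ((E f).map (var f us c)) →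
      ∃ as, us = Term.name ∘ as := by
    intro f us c h
    obtain ⟨q, hq, -⟩ := (ParityGame.defenderWins_iff_of_defender (owner_map_var f us c)).mp h
    rw [map_var] at hq
    obtain ⟨as, h, -⟩ := gameMove_fix.mp hq
    exact ⟨as, h⟩
  have wins_fix : G.DefenderWins (⟨c, ξ, .fix σ X xs φ us⟩ : Position A S T) ↔
      ∃ as, us = Term.name ∘ as ∧ c ∈ g as := by
    constructor
    · intro h
      obtain ⟨as, rfl⟩ := wins_map_var g us c (by rwa [map_var])
      exact ⟨as, rfl, h⟩
    · rintro ⟨as, rfl, h⟩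
      exact h
  have ih' : ∀ f as c, c ∈ 𝓛.sem act (φ.instN xs as) (Function.update ξ X f) ↔
      G.DefenderWins (body f as c) := fun f as c => ih as _ c
  rw [wins_fix]
  cases σ with
  | mu =>
    rw [FLTS.sem]
    simp only [Set.mem_ofPred_eq, sInf_apply, Set.iInf_eq_iInter, Set.mem_iInter, Subtype.forall]
    refine exists_congr fun as => and_congr_right fun _ => ⟨fun h => h g fun bs c' hc' => ?_,
      fun h f hf => ?_⟩
    -- `g` is a prefixpoint: a sink that is won when `X` has the value `g` is mapped to a fixpoint
    -- position that is won by the definition of `g`.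
    · rw [mem_g g]
      refine (E g).defenderWins_map (fun q hq hs hw => ?_) (body_mem g bs c') ((ih' _ _ _).mp hc')
      obtain ⟨us, c, rfl⟩ := sink_eq g q hq hs
      obtain ⟨as, rfl, h⟩ := (wins_var g us c).mp hw
      rw [map_var]
      exact h
    -- Every prefixpoint `f` contains `g`, by induction along the returns to `X` under `τ`: if `f`
    -- holds at all sinks reached later, then the body game with value `f` is won, so the body holds
    -- there by `ih'`, and `f` holds since it is a prefixpoint.
    · obtain ⟨τ, hτ⟩ := G.exists_uniform_strategy
      have key := (E f).sink_induction_of_odd hp (τ := τ) (P := fun q => G.owner q = .attacker)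
        (fun t ht hs hw hind => ?_) (t := var f (Term.name ∘ as) c)
        ⟨rfl, trivial, by simp [var, Formula.boundRVars]⟩ ⟨_, rfl⟩
        (by rw [map_var]; exact hτ _ h)
      · obtain ⟨bs, h, hc⟩ := (owner_var _ _ _).mp key
        obtain rfl : as = bs := funext fun i => Term.name.inj (congrFun h i)
        exact hc
      · obtain ⟨us, c, rfl⟩ := sink_eq f t ht hs
        obtain ⟨bs, rfl⟩ := wins_map_var f us c ⟨τ, hw⟩
        have hf1 : G.Follows τ ((E f).map (var f (Term.name ∘ bs) c)) ((E f).map (body f bs c)) :=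
          ⟨(move_var _ _ _ _).mpr rfl, fun ho => (move_var _ _ _ _).mp (hw.move ho)⟩
        refine (owner_var _ _ _).mpr ⟨bs, rfl, hf bs ((ih' _ _ _).mpr ?_)⟩
        exact (E f).defenderWins_of_map (body_mem f bs c) (hw.of_follows hf1)
          fun t ht hs hr => hind t ht hs (.head' hf1 hr)
  | nu =>
    rw [FLTS.sem]
    simp only [Set.mem_ofPred_eq, sSup_apply, Set.iSup_eq_iUnion, Set.mem_iUnion, Subtype.exists,
      exists_prop]
    refine exists_congr fun as => and_congr_right fun _ => ⟨fun ⟨f, hf, h⟩ => ?_,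
      fun h => ⟨g, fun bs c' hc' => ?_, h⟩⟩
    -- Every postfixpoint `f` lies below `g`: at a sink where `f` holds, the body holds too, so by
    -- `ih'` Defender can re-enter the body game at a won position.
    · rw [mem_g f]
      refine (E f).defenderWins_map_of_even hp (fun q hq hs hw => ?_) (body_mem f as c)
        ((ih' _ _ _).mp (hf as h))
      obtain ⟨us, c, rfl⟩ := sink_eq f q hq hs
      obtain ⟨bs, rfl, h⟩ := (wins_var f us c).mp hw
      exact ⟨_, body_mem f bs c, (ih' _ _ _).mp (hf bs h), (move_var _ _ _ _).mpr rfl⟩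
    -- `g` is a postfixpoint: a strategy that wins from the image of the body still wins at the
    -- image of each sink it reaches, so `g` holds at that sink.
    · obtain ⟨τ, hτ⟩ := (mem_g g _ _).mp hc'
      refine (ih' _ _ _).mpr ((E g).defenderWins_of_map (body_mem g bs c') hτ fun t ht hs hr => ?_)
      obtain ⟨us, c, rfl⟩ := sink_eq g t ht hs
      have hw : G.DefenderWins ((E g).map (var g us c)) := ⟨τ, hτ.of_reflTransGen hr⟩
      obtain ⟨cs, rfl⟩ := wins_map_var g us c hw
      rw [map_var] at hw
      exact (owner_var _ _ _).mpr ⟨cs, rfl, hw⟩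

/-- The set `B` stays fixed in the induction, so that variables which become free in the bodies of
their operators keep their rank inequalities. Induction on size rather than structure covers
instances, which have the size of the formula they come from. -/
theorem mem_sem_iff_wins {B : Set RVar} {Ω : RVar → ℕ} (φ : Formula A T)
    (hr : φ.Ranked B Ω) (hc : φ.freeNames = ∅) (hn : φ.boundRVars.Nodup)
    (hd : ∀ X ∈ φ.boundRVars, X ∉ φ.freeRVars) (ξ : Valuation A S) (c : Conf A S) :
    c ∈ 𝓛.sem act φ ξ ↔ 𝓛.Wins act Ω ⟨c, ξ, φ⟩ := by
  induction hk : φ.size using Nat.strong_induction_on generalizing φ ξ c with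
  | h k ih =>
  subst hk
  cases φ with
  | eq u v =>
    rw [FLTS.sem]
    by_cases h : u = v
    · rw [wins_iff_of_attacker (by simp [Position.owner, h])]
      simp [h]
    · rw [wins_iff_of_defender (by simp [Position.owner, h])]
      simp [h]
  | ne u v =>
    rw [FLTS.sem]
    by_cases h : u = v
    · rw [wins_iff_of_defender (by simp [Position.owner, h])]
      simp [h]
    · rw [wins_iff_of_attacker (by simp [Position.owner, h])]
      simp [h]
  | rvar X us =>
    rw [FLTS.sem]
    by_cases h : ∃ as, us = Term.name ∘ as ∧ c ∈ ξ X as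
    · rw [wins_iff_of_attacker (by simp [Position.owner, h])]
      simp [h]
    · rw [wins_iff_of_defender (by simp [Position.owner, h])]
      simp [h]
  | neg φ => exact hr.elim
  | or φ₁ φ₂ | and φ₁ φ₂ =>
    simp only [Formula.freeNames, Set.union_empty_iff] at hc
    simp only [Formula.boundRVars, List.nodup_append'] at hn
    have h1 := fun ξ c => ih _ (by simp only [Formula.size]; omega) φ₁ hr.1 hc.1 hn.1
      (fun X hX hf => hd X (List.mem_append_left _ hX) (.inl hf)) ξ c rfl
    have h2 := fun ξ c => ih _ (by simp only [Formula.size]; omega) φ₂ hr.2 hc.2 hn.2.1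
      (fun X hX hf => hd X (List.mem_append_right _ hX) (.inr hf)) ξ c rfl
    rw [FLTS.sem]
    first
    | rw [wins_iff_of_defender rfl]
      simp [h1, h2, or_and_right, exists_or]
    | rw [wins_iff_of_attacker rfl]
      simp [h1, h2, or_imp, forall_and]
  | bigOr x φ | bigAnd x φ | fresh x φ | freshAll x φ =>
    have h1 := fun a ξ c => ih _ (by simp [Formula.size]) (φ.inst1 x a) (by simpa [Formula.Ranked] using hr)
      (Formula.freeNames_inst1 hc a) (by simpa [Formula.boundRVars] using hn)
      (by simpa [Formula.boundRVars, Formula.freeRVars] using hd) ξ c rfl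
    rw [FLTS.sem]
    first
    | rw [wins_iff_of_defender rfl]
      simp [h1]
    | rw [wins_iff_of_attacker rfl]
      simp only [Set.mem_iInter, Set.mem_ofPred_eq, h1, gameMove_bigAnd, gameMove_freshAll]
      grind
  | dia t us φ | box t us φ =>
    simp only [Formula.freeNames, Set.union_empty_iff] at hc
    have h1 := fun ξ c => ih _ (by simp [Formula.size]) φ hr hc.2 hn hd ξ c rfl
    rw [FLTS.sem]
    first
    | rw [wins_iff_of_defender rfl]
      simp [h1]
    | rw [wins_iff_of_attacker rfl]
      simp only [Set.mem_ofPred_eq, h1, gameMove_box]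
      grind
  | fix σ X xs φ us =>
    simp only [Formula.freeNames, Set.union_empty_iff, Set.sdiff_eq_empty] at hc
    simp only [Formula.boundRVars, List.nodup_cons] at hn
    have hb : ∀ Z ∈ φ.boundRVars, Z ≠ X ∧ Z ∉ φ.freeRVars := by
      intro Z hZ
      have hZX : Z ≠ X := by
        rintro rfl
        exact hn.1 hZ
      exact ⟨hZX, fun h => hd Z (List.mem_cons_of_mem _ hZ) ⟨h, hZX⟩⟩
    refine mem_sem_fix_iff 𝓛 act hr.1 hr.2.1 hr.2.2.2 hc.1 hb (fun as ξ c => ?_) ξ c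
    exact ih _ (by simp [Formula.size]) _ (by simpa using hr.2.2.2)
      (Formula.freeNames_instN hc.1 as) (by simpa using hn.2)
      (by simpa using fun Z hZ => (hb Z hZ).2) ξ c rfl

end Game

theorem Formula.IsRanking.ranked {A : Type u} {T : Type t} {φ : Formula A T} {Ω : RVar → ℕ}
    (h : φ.IsRanking Ω) (hneg : φ.NegationFree) : φ.Ranked {X | X ∈ φ.boundRVars} Ω :=
  ranked_of_subformulas hneg fun σ X xs χ us hχ => ⟨mem_boundRVars_of_fix_mem hχ, by
    cases σ
    · exact h.odd_mu X xs χ us hχ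
    · exact h.even_nu X xs χ us hχ, fun Y hY hf => h.le_of_dep Y hY σ X xs χ us hχ hf⟩

end FHML

theorem mainTheorem2 {A : Type*} {S : Type*} {L : Type*} {T : Type*}
    [DecidableEq A] [Countable A] [Infinite A] [FHML.NominalSet A S] [FHML.NominalSet A L]
    (𝓛 : FHML.FLTS A S L) (h𝓛 : 𝓛.FreshOrbitFinite) (act : FHML.ActionTerms A T L)
    (φ : FHML.Formula A T) (hφ : φ.WellNamed) (hneg : φ.NegationFree)
    (ξ : FHML.Valuation A S) (Ω : FHML.RVar → ℕ) (hΩ : φ.IsRanking Ω) (c : FHML.Conf A S) :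
    c ∈ 𝓛.sem act φ ξ ↔ (𝓛.game act Ω).DefenderWins ⟨c, ξ, φ⟩ :=
  FHML.mem_sem_iff_wins 𝓛 act φ (hΩ.ranked hneg) hφ.closed hφ.bound_nodup
    (fun X hX hf => hφ.free_not_bound X hf hX) ξ c
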